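/- **Conventions.** For a lattice $\Gamma\subset\mathbb R^d$, $OC(\Gamma)$ is the group of all $R\in O(d)$ such that $\Gamma\cap R\Gamma$ has finite index in both $\Gamma$ and $R\Gamma$, and $SOC(\Gamma)=OC(\Gamma)\cap SO(d)$; for $R\in OC(\Gamma)$ the lattice $\Gamma\cap R\Gamma$ is called a coincidence site lattice (CSL) of $\Gamma$, and its index is $[\Gamma:\Gamma\cap R\Gamma]$. For $x\in\mathbb R^d$, a cosublattice of $x+\Gamma$ of index $m$ is a set $x+\ell+\Gamma'$ with $\ell\in\Gamma$ and $\Gamma'\le\Gamma$ a subgroup of finite index $m$. The set $OC(x+\Gamma)$ consists of all $R\in O(d)$ for which $(x+\Gamma)\cap R(x+\Gamma)$ is a cosublattice of $x+\Gamma$; this intersection is then a CSL of $x+\Gamma$, and its index is the coincidence index of $R$ with respect to $x+\Gamma$. Put $SOC(x+\Gamma)=OC(x+\Gamma)\cap SO(d)$. A quaternion $q=(q_0,q_1,q_2,q_3)$ is primitive if its components are integers without a common factor; $|q|^2=q_0^2+q_1^2+q_2^2+q_3^2$. Identifying $\mathbb R^3$ with the space of purely imaginary quaternions, let $R_q(v)=qvq^{-1}$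 and $T_q(v)=-qvq^{-1}$ for $q$ primitive. **Lemma.** Let $\Gamma=2\mathbb Z^3\cup[(1,1,0)+2\mathbb Z^3]\cup[(0,1,1)+2\mathbb Z^3]\cup[(1,0,1)+2\mathbb Z^3]$ be the face-centred cubic lattice and let $x=\tfrac12(1,1,1)$. Then $SOC(x+\Gamma)$ is a subgroup of $SOC(\Gamma)$ of index $2$, $OC(x+\Gamma)$ is a subgroup of $OC(\Gamma)$ of index $2$, and $$SOC(x+\Gamma)=\{R_q : q \text{ primitive},\ |q|^2\not\equiv 2 \pmod 4\},$$ $$OC(x+\Gamma)=SOC(x+\Gamma)\cup\{T_q : q\text{ primitive},\ |q|^2\equiv 2\pmod 4\}.$$ For every $m\in\mathbb N$ let $f_{x+\Gamma}(m)$, $\hat f_{x+\Gamma}(m)$ and $\hat F_{x+\Gamma}(m)$ be the numbers of CSLs of $x+\Gamma$ of index $m$, of elements of $SOC(x+\Gamma)$ of coincidence index $m$, and of elements of $OC(x+\Gamma)$ of coincidence index $m$, and let $f_{\mathbb Z^3}(m)$ be the number of CSLs of $\mathbb Z^3$ of index $m$. These numbers are finite, and $$f_{x+\Gamma}(m)=f_{\mathbb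 Z^3}(m),\qquad \hat f_{x+\Gamma}(m)=12\,f_{x+\Gamma}(m),\qquad \hat F_{x+\Gamma}(m)=24\,f_{x+\Gamma}(m).$$ -/

import Mathlib

namespace CoincidenceLattice

/-! ### Linear coincidences of lattices and of shifted lattices in `ℝᵈ` -/

/-- The action of an orthogonal matrix on `ℝᵈ` (column vectors). -/
def act {d : ℕ} (R : Matrix.orthogonalGroup (Fin d) ℝ) : (Fin d → ℝ) →+ (Fin d → ℝ) :=
  (Matrix.mulVecLin (R : Matrix (Fin d) (Fin d) ℝ)).toAddMonoidHom

theorem act_apply {d : ℕ} (R : Matrix.orthogonalGroup (Fin d) ℝ) (v : Fin d → ℝ) :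
    act R v = Matrix.mulVec (R : Matrix (Fin d) (Fin d) ℝ) v := rfl

/-- The image `RΓ` of a lattice `Γ`. -/
def rotate {d : ℕ} (R : Matrix.orthogonalGroup (Fin d) ℝ) (Γ : AddSubgroup (Fin d → ℝ)) :
    AddSubgroup (Fin d → ℝ) :=
  Γ.map (act R)

theorem rotate_one {d : ℕ} (Γ : AddSubgroup (Fin d → ℝ)) : rotate 1 Γ = Γ := by
  ext v
  simp [rotate, act_apply]

theorem rotate_mul {d : ℕ} (R S : Matrix.orthogonalGroup (Fin d) ℝ)
    (Γ : AddSubgroup (Fin d → ℝ)) : rotate (R * S) Γ = rotate R (rotate S Γ) := by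
  ext v
  simp [rotate, act_apply, Matrix.mulVec_mulVec]

theorem act_injective {d : ℕ} (R : Matrix.orthogonalGroup (Fin d) ℝ) :
    Function.Injective (act R) := by
  intro v w h
  have h2 := congrArg (act R⁻¹) h
  rw [act_apply, act_apply, act_apply, act_apply, Matrix.mulVec_mulVec, Matrix.mulVec_mulVec,
    ← Matrix.UnitaryGroup.mul_val, inv_mul_cancel] at h2
  simpa using h2

theorem rotate_commensurable {d : ℕ} (R : Matrix.orthogonalGroup (Fin d) ℝ)
    {Γ Δ : AddSubgroup (Fin d → ℝ)} (h : AddSubgroup.Commensurable Γ Δ) :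
    AddSubgroup.Commensurable (rotate R Γ) (rotate R Δ) := by
  unfold AddSubgroup.Commensurable rotate at *
  rw [AddSubgroup.relIndex_map_map_of_injective _ _ (act_injective R),
    AddSubgroup.relIndex_map_map_of_injective _ _ (act_injective R)]
  exact h

/-- The group `OC(Γ)` of linear coincidence isometries of a lattice `Γ`: all `R ∈ O(d)` such that
`Γ ∩ RΓ` has finite index both in `Γ` and in `RΓ`. -/
def OC {d : ℕ} (Γ : AddSubgroup (Fin d → ℝ)) : Subgroup (Matrix.orthogonalGroup (Fin d) ℝ) where
  carrier := {R | AddSubgroup.Commensurable Γ (rotate R Γ)}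
  one_mem' := by
    simp only [Set.mem_ofPred_eq, rotate_one]
    exact AddSubgroup.Commensurable.refl Γ
  mul_mem' := by
    intro R S hR hS
    simp only [Set.mem_ofPred_eq, rotate_mul] at *
    exact hR.trans (rotate_commensurable R hS)
  inv_mem' := by
    intro R hR
    simp only [Set.mem_ofPred_eq] at *
    have h := rotate_commensurable R⁻¹ hR
    rw [← rotate_mul, inv_mul_cancel, rotate_one] at h
    exact h.symm

/-- The rotation group `SO(d)` as a subgroup of `O(d)`. -/
def SO (d : ℕ) : Subgroup (Matrix.orthogonalGroup (Fin d) ℝ) where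
  carrier := {R | (R : Matrix (Fin d) (Fin d) ℝ).det = 1}
  one_mem' := by simp
  mul_mem' := by
    intro R S hR hS
    simp only [Set.mem_ofPred_eq, Matrix.UnitaryGroup.mul_val, Matrix.det_mul] at *
    rw [hR, hS, one_mul]
  inv_mem' := by
    intro R hR
    simp only [Set.mem_ofPred_eq] at *
    have h : ((R⁻¹ * R : Matrix.orthogonalGroup (Fin d) ℝ) : Matrix (Fin d) (Fin d) ℝ).det = 1 := by
      simp
    rw [Matrix.UnitaryGroup.mul_val, Matrix.det_mul, hR, mul_one] at h
    exact h

/-- The group `SOC(Γ) = OC(Γ) ∩ SO(d)` of coincidence rotations of a lattice `Γ`. -/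
def SOC {d : ℕ} (Γ : AddSubgroup (Fin d → ℝ)) : Subgroup (Matrix.orthogonalGroup (Fin d) ℝ) :=
  OC Γ ⊓ SO d

/-- The coincidence site lattices `Γ(R) = Γ ∩ RΓ`, `R ∈ OC(Γ)`, with index `[Γ : Γ(R)] = m`. -/
def cslSet {d : ℕ} (Γ : AddSubgroup (Fin d → ℝ)) (m : ℕ) : Set (AddSubgroup (Fin d → ℝ)) :=
  {L | ∃ R ∈ OC Γ, L = Γ ⊓ rotate R Γ ∧ L.relIndex Γ = m}

/-- The shifted lattice `x + Γ`. -/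
def shifted {d : ℕ} (x : Fin d → ℝ) (Γ : AddSubgroup (Fin d → ℝ)) : Set (Fin d → ℝ) :=
  {v | ∃ g ∈ Γ, v = x + g}

/-- `S` is a cosublattice of `x + Γ` of (finite) index `m`: a set `x + (ℓ + Γ')` with `ℓ ∈ Γ` and
`Γ'` a subgroup of `Γ` of index `m ≠ 0` (for an infinite index Mathlib's `relIndex` is `0`). -/
def IsCosublattice {d : ℕ} (x : Fin d → ℝ) (Γ : AddSubgroup (Fin d → ℝ)) (S : Set (Fin d → ℝ))
    (m : ℕ) : Prop :=
  m ≠ 0 ∧ ∃ l ∈ Γ, ∃ Γ' : AddSubgroup (Fin d → ℝ),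
    Γ' ≤ Γ ∧ Γ'.relIndex Γ = m ∧ S = shifted (x + l) Γ'

/-- The intersection `(x + Γ) ∩ R(x + Γ)`. -/
def shiftedInter {d : ℕ} (x : Fin d → ℝ) (Γ : AddSubgroup (Fin d → ℝ))
    (R : Matrix.orthogonalGroup (Fin d) ℝ) : Set (Fin d → ℝ) :=
  shifted x Γ ∩ act R '' shifted x Γ

/-- The linear coincidence isometries of `x + Γ` with coincidence index `m`. -/
def shiftedOCIndex {d : ℕ} (x : Fin d → ℝ) (Γ : AddSubgroup (Fin d → ℝ)) (m : ℕ) :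
    Set (Matrix.orthogonalGroup (Fin d) ℝ) :=
  {R | IsCosublattice x Γ (shiftedInter x Γ R) m}

/-- The coincidence rotations of `x + Γ` with coincidence index `m`. -/
def shiftedSOCIndex {d : ℕ} (x : Fin d → ℝ) (Γ : AddSubgroup (Fin d → ℝ)) (m : ℕ) :
    Set (Matrix.orthogonalGroup (Fin d) ℝ) :=
  shiftedOCIndex x Γ m ∩ SO d

/-- The set `OC(x + Γ)` of all linear coincidence isometries of the shifted lattice `x + Γ`: those
`R ∈ O(d)` for which `(x + Γ) ∩ R(x + Γ)` is a cosublattice of `x + Γ`. -/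
def shiftedOC {d : ℕ} (x : Fin d → ℝ) (Γ : AddSubgroup (Fin d → ℝ)) :
    Set (Matrix.orthogonalGroup (Fin d) ℝ) :=
  {R | ∃ m : ℕ, IsCosublattice x Γ (shiftedInter x Γ R) m}

/-- `SOC(x + Γ) = OC(x + Γ) ∩ SO(d)`. -/
def shiftedSOC {d : ℕ} (x : Fin d → ℝ) (Γ : AddSubgroup (Fin d → ℝ)) :
    Set (Matrix.orthogonalGroup (Fin d) ℝ) :=
  shiftedOC x Γ ∩ SO d

/-- The CSLs `(x + Γ) ∩ R(x + Γ)`, `R ∈ OC(x + Γ)`, of `x + Γ` of index `m`. -/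
def shiftedCslSet {d : ℕ} (x : Fin d → ℝ) (Γ : AddSubgroup (Fin d → ℝ)) (m : ℕ) :
    Set (Set (Fin d → ℝ)) :=
  {S | ∃ R ∈ shiftedOC x Γ, S = shiftedInter x Γ R ∧ IsCosublattice x Γ S m}

/-! ### The cubic lattices -/

/-- The primitive cubic lattice `ℤ³`. -/
def cubic : AddSubgroup (Fin 3 → ℝ) where
  carrier := {v | ∃ n : Fin 3 → ℤ, ∀ i, v i = n i}
  zero_mem' := ⟨0, by simp⟩
  add_mem' := by
    rintro v w ⟨n, hn⟩ ⟨k, hk⟩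
    exact ⟨n + k, fun i => by simp [hn i, hk i]⟩
  neg_mem' := by
    rintro v ⟨n, hn⟩
    exact ⟨-n, fun i => by simp [hn i]⟩

/-- The face-centred cubic lattice: the union of `2ℤ³` and its translates by `(1,1,0)`, `(0,1,1)`
and `(1,0,1)`. -/
def fcc : AddSubgroup (Fin 3 → ℝ) where
  carrier := {v | ∃ t : Fin 3 → ℤ, (t = ![0, 0, 0] ∨ t = ![1, 1, 0] ∨ t = ![0, 1, 1] ∨
    t = ![1, 0, 1]) ∧ ∃ n : Fin 3 → ℤ, ∀ i, v i = t i + 2 * n i}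
  zero_mem' := ⟨![0, 0, 0], Or.inl rfl, 0, fun i => by fin_cases i <;> simp⟩
  add_mem' := by
    rintro v w ⟨t, ht, n, hn⟩ ⟨s, hs, k, hk⟩
    rcases ht with rfl | rfl | rfl | rfl <;> rcases hs with rfl | rfl | rfl | rfl
    · exact ⟨_, Or.inl rfl, n + k, fun i => by fin_cases i <;> simp [hn, hk] <;> ring⟩
    · exact ⟨_, Or.inr (Or.inl rfl), n + k, fun i => by fin_cases i <;> simp [hn, hk] <;> ring⟩
    · exact ⟨_, Or.inr (Or.inr (Or.inl rfl)), n + k, fun i => by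
        fin_cases i <;> simp [hn, hk] <;> ring⟩
    · exact ⟨_, Or.inr (Or.inr (Or.inr rfl)), n + k, fun i => by
        fin_cases i <;> simp [hn, hk] <;> ring⟩
    · exact ⟨_, Or.inr (Or.inl rfl), n + k, fun i => by fin_cases i <;> simp [hn, hk] <;> ring⟩
    · exact ⟨_, Or.inl rfl, n + k + ![1, 1, 0], fun i => by
        fin_cases i <;> simp [hn, hk] <;> ring⟩
    · exact ⟨_, Or.inr (Or.inr (Or.inr rfl)), n + k + ![0, 1, 0], fun i => by
        fin_cases i <;> simp [hn, hk] <;> ring⟩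
    · exact ⟨_, Or.inr (Or.inr (Or.inl rfl)), n + k + ![1, 0, 0], fun i => by
        fin_cases i <;> simp [hn, hk] <;> ring⟩
    · exact ⟨_, Or.inr (Or.inr (Or.inl rfl)), n + k, fun i => by
        fin_cases i <;> simp [hn, hk] <;> ring⟩
    · exact ⟨_, Or.inr (Or.inr (Or.inr rfl)), n + k + ![0, 1, 0], fun i => by
        fin_cases i <;> simp [hn, hk] <;> ring⟩
    · exact ⟨_, Or.inl rfl, n + k + ![0, 1, 1], fun i => by
        fin_cases i <;> simp [hn, hk] <;> ring⟩
    · exact ⟨_, Or.inr (Or.inl rfl), n + k + ![0, 0, 1], fun i => by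
        fin_cases i <;> simp [hn, hk] <;> ring⟩
    · exact ⟨_, Or.inr (Or.inr (Or.inr rfl)), n + k, fun i => by
        fin_cases i <;> simp [hn, hk] <;> ring⟩
    · exact ⟨_, Or.inr (Or.inr (Or.inl rfl)), n + k + ![1, 0, 0], fun i => by
        fin_cases i <;> simp [hn, hk] <;> ring⟩
    · exact ⟨_, Or.inr (Or.inl rfl), n + k + ![0, 0, 1], fun i => by
        fin_cases i <;> simp [hn, hk] <;> ring⟩
    · exact ⟨_, Or.inl rfl, n + k + ![1, 0, 1], fun i => by
        fin_cases i <;> simp [hn, hk] <;> ring⟩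
  neg_mem' := by
    rintro v ⟨t, ht, n, hn⟩
    refine ⟨t, ht, -n - t, fun i => ?_⟩
    simp [hn i]
    ring

/-! ### Rotations given by quaternions -/

/-- The identification of `ℝ³` with the imaginary space of the quaternions. -/
def toIm (v : Fin 3 → ℝ) : Quaternion ℝ := ⟨0, v 0, v 1, v 2⟩

/-- The imaginary part of a quaternion as a vector in `ℝ³`. -/
def imPart (q : Quaternion ℝ) : Fin 3 → ℝ := ![q.imI, q.imJ, q.imK]

/-- A primitive quaternion: four integer components without a common factor. -/
def IsPrimitive (q : Quaternion ℤ) : Prop :=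
  ∀ a : ℤ, a ∣ q.re → a ∣ q.imI → a ∣ q.imJ → a ∣ q.imK → IsUnit a

/-- A quaternion with integer components as a real quaternion. -/
def toReal (q : Quaternion ℤ) : Quaternion ℝ := ⟨q.re, q.imI, q.imJ, q.imK⟩

theorem normSq_int (q : Quaternion ℤ) :
    Quaternion.normSq q = q.re ^ 2 + q.imI ^ 2 + q.imJ ^ 2 + q.imK ^ 2 :=
  Quaternion.normSq_def' q

theorem toReal_ne_zero {q : Quaternion ℤ} (hq : IsPrimitive q) : toReal q ≠ 0 := by
  intro h
  have h0 : q.re = 0 := Int.cast_eq_zero.mp (congrArg QuaternionAlgebra.re h : (q.re : ℝ) = 0)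
  have h1 : q.imI = 0 := Int.cast_eq_zero.mp (congrArg QuaternionAlgebra.imI h : (q.imI : ℝ) = 0)
  have h2 : q.imJ = 0 := Int.cast_eq_zero.mp (congrArg QuaternionAlgebra.imJ h : (q.imJ : ℝ) = 0)
  have h3 : q.imK = 0 := Int.cast_eq_zero.mp (congrArg QuaternionAlgebra.imK h : (q.imK : ℝ) = 0)
  have := hq 0 (by rw [h0]) (by rw [h1]) (by rw [h2]) (by rw [h3])
  simp at this

/-- The matrix of `v ↦ q v q⁻¹` on `Im ℍ = ℝ³`; its `j`-th column is the image of the `j`-th unit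
vector. -/
noncomputable def conjMatrix (q : Quaternion ℝ) : Matrix (Fin 3) (Fin 3) ℝ :=
  Matrix.of fun i j => imPart (q * toIm (Pi.single j 1) * q⁻¹) i

theorem imPart_conj (q : Quaternion ℝ) (v : Fin 3 → ℝ) :
    imPart (q * toIm v * q⁻¹) = (Quaternion.normSq q)⁻¹ • ![
      (q.re ^ 2 + q.imI ^ 2 - q.imJ ^ 2 - q.imK ^ 2) * v 0
        + (-2 * q.re * q.imK + 2 * q.imI * q.imJ) * v 1
        + (2 * q.re * q.imJ + 2 * q.imI * q.imK) * v 2,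
      (2 * q.re * q.imK + 2 * q.imI * q.imJ) * v 0
        + (q.re ^ 2 - q.imI ^ 2 + q.imJ ^ 2 - q.imK ^ 2) * v 1
        + (-2 * q.re * q.imI + 2 * q.imJ * q.imK) * v 2,
      (-2 * q.re * q.imJ + 2 * q.imI * q.imK) * v 0
        + (2 * q.re * q.imI + 2 * q.imJ * q.imK) * v 1
        + (q.re ^ 2 - q.imI ^ 2 - q.imJ ^ 2 + q.imK ^ 2) * v 2] := by
  have e0 : (toIm v).re = 0 := rfl
  have e1 : (toIm v).imI = v 0 := rfl
  have e2 : (toIm v).imJ = v 1 := rfl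
  have e3 : (toIm v).imK = v 2 := rfl
  ext i
  fin_cases i <;> simp [imPart, Quaternion.inv_def, e0, e1, e2, e3] <;>
    exact Or.inl (by ring)

theorem re_conj (q : Quaternion ℝ) (v : Fin 3 → ℝ) : (q * toIm v * q⁻¹).re = 0 := by
  have e0 : (toIm v).re = 0 := rfl
  have e1 : (toIm v).imI = v 0 := rfl
  have e2 : (toIm v).imJ = v 1 := rfl
  have e3 : (toIm v).imK = v 2 := rfl
  simp [Quaternion.inv_def, e0, e1, e2, e3]
  exact Or.inr (by ring)

/-- The explicit form of the matrix of `v ↦ q v q⁻¹`. -/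
theorem conjMatrix_eq (q : Quaternion ℝ) :
    conjMatrix q = (Quaternion.normSq q)⁻¹ • !![
      q.re ^ 2 + q.imI ^ 2 - q.imJ ^ 2 - q.imK ^ 2, -2 * q.re * q.imK + 2 * q.imI * q.imJ,
        2 * q.re * q.imJ + 2 * q.imI * q.imK;
      2 * q.re * q.imK + 2 * q.imI * q.imJ, q.re ^ 2 - q.imI ^ 2 + q.imJ ^ 2 - q.imK ^ 2,
        -2 * q.re * q.imI + 2 * q.imJ * q.imK;
      -2 * q.re * q.imJ + 2 * q.imI * q.imK, 2 * q.re * q.imI + 2 * q.imJ * q.imK,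
        q.re ^ 2 - q.imI ^ 2 - q.imJ ^ 2 + q.imK ^ 2] := by
  ext i j
  simp only [conjMatrix, imPart_conj]
  fin_cases i <;> fin_cases j <;> simp

/-- `conjMatrix q` really is the map `v ↦ q v q⁻¹` on all of `Im ℍ`. -/
theorem toIm_conjMatrix (q : Quaternion ℝ) (v : Fin 3 → ℝ) :
    toIm (Matrix.mulVec (conjMatrix q) v) = q * toIm v * q⁻¹ := by
  have h : Matrix.mulVec (conjMatrix q) v = imPart (q * toIm v * q⁻¹) := by
    rw [imPart_conj, conjMatrix_eq]
    ext i
    fin_cases i <;> simp [Matrix.mulVec, dotProduct, Fin.sum_univ_three] <;> ring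
  rw [h]
  ext
  · exact (re_conj q v).symm
  · rfl
  · rfl
  · rfl

theorem conjMatrix_mem {q : Quaternion ℝ} (hq : q ≠ 0) :
    conjMatrix q ∈ Matrix.orthogonalGroup (Fin 3) ℝ := by
  have hN : Quaternion.normSq q ≠ 0 := by simpa using hq
  have h : (Quaternion.normSq q)⁻¹ * (q.re ^ 2 + q.imI ^ 2 + q.imJ ^ 2 + q.imK ^ 2) = 1 := by
    rw [← Quaternion.normSq_def']
    exact inv_mul_cancel₀ hN
  rw [Matrix.mem_orthogonalGroup_iff]
  rw [conjMatrix_eq]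
  generalize (Quaternion.normSq q)⁻¹ = s at h
  ext i j
  fin_cases i <;> fin_cases j <;>
    simp [Matrix.mul_apply, Fin.sum_univ_three] <;>
    first
    | (ring1)
    | linear_combination (s * (q.re ^ 2 + q.imI ^ 2 + q.imJ ^ 2 + q.imK ^ 2) + 1) * h

/-- The rotation `R_q : v ↦ q v q⁻¹` of `ℝ³ = Im ℍ`, for a primitive quaternion `q`. -/
noncomputable def rotOf (q : Quaternion ℤ) (hq : IsPrimitive q) :
    Matrix.orthogonalGroup (Fin 3) ℝ :=
  ⟨conjMatrix (toReal q), conjMatrix_mem (toReal_ne_zero hq)⟩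

/-- The rotoreflection `T_q = -R_q : v ↦ -q v q⁻¹`, for a primitive quaternion `q`. -/
noncomputable def roflOf (q : Quaternion ℤ) (hq : IsPrimitive q) :
    Matrix.orthogonalGroup (Fin 3) ℝ :=
  -rotOf q hq

end CoincidenceLattice

namespace CoincidenceLattice

open Matrix

/-! Write `x = ½(1,1,1)` and `Γ` for the face-centred cubic lattice. `Γ` is the even-norm sublattice
of `ℤ³`, of index 2, so both have the same coincidence isometries. Such an isometry `R` has a least
denominator `N`, and `N` is odd (`IsDenom.odd`).

The set `(x + Γ) ∩ R(x + Γ)` is empty or a coset of `Γ ∩ RΓ`, and is nonempty exactly when `Rx - x ∈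
Γ + RΓ`. As `N` is odd, this means `N(Rx - x) ∈ Γ` (`Clears.act_halfDiag_sub_mem_iff`), while `N(Rx
- x) ∈ ℤ³` always holds. The class in `ℤ³/Γ ≅ ℤ/2` is multiplicative in `R`
(`mul_mem_shiftedOC_iff`) and nontrivial on a quarter turn, whence both indices 2. Every coincidence
rotation is some `R_q` (`exists_rotOf_eq`), and its class can be read off `|q|²R_q` modulo powers of
2 (`rotOf_mem_shiftedGroup_iff`). Since `-1` has nontrivial class, the improper elements are the
`T_q` with `R_q` outside the group.

For the counts, the maps `R ↦ (x + Γ) ∩ R(x + Γ)` and `R ↦ ℤ³ ∩ Rℤ³`, restricted to the rotations in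
`OC(x + Γ)` of index `m`, have the same fibres: left cosets of the tetrahedral rotation group, of
order 12. The hard point is that `ℤ³ ∩ Rℤ³` determines `Rℤ³` (`inf_rotate_eq_iff`), by duality and
the oddness of `N`. Both maps reach every CSL of index `m`, because the quarter turn and a
coordinate swap preserve `ℤ³` and correct the class and the determinant. The swap also turns 12 into
24. -/

/-- The integers as a subring of `ℝ`. -/
def ints : Subring ℝ := (Int.castRingHom ℝ).range

theorem intCast_mem_ints (n : ℤ) : (n : ℝ) ∈ ints := ⟨n, rfl⟩

theorem mem_cubic {v : Fin 3 → ℝ} : v ∈ cubic ↔ ∀ i, v i ∈ ints := by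
  constructor
  · rintro ⟨n, hn⟩ i
    exact ⟨n i, (hn i).symm⟩
  · intro h
    choose n hn using h
    exact ⟨n, fun i => (hn i).symm⟩

theorem single_mem_cubic (j : Fin 3) : (Pi.single j 1 : Fin 3 → ℝ) ∈ cubic := by
  rw [mem_cubic]
  intro i
  by_cases h : i = j
  · subst h; simp
  · simp [h]

theorem dotProduct_mem_ints {v w : Fin 3 → ℝ} (hv : v ∈ cubic) (hw : w ∈ cubic) :
    v ⬝ᵥ w ∈ ints :=
  sum_mem fun i _ => mul_mem (mem_cubic.1 hv i) (mem_cubic.1 hw i)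

theorem ints_of_two_mul {t : ℝ} {N : ℤ} (hN : Odd N) (h2 : 2 * t ∈ ints) (h : (N : ℝ) * t ∈ ints) :
    t ∈ ints := by
  obtain ⟨k, rfl⟩ := hN
  have : t = ((2 * k + 1 : ℤ) : ℝ) * t - (k : ℝ) * (2 * t) := by push_cast; ring
  rw [this]
  exact sub_mem h (mul_mem (intCast_mem_ints k) h2)

/-! ### Orthogonal matrices acting on the cubic lattice -/

theorem transpose_mul_self (R : Matrix.orthogonalGroup (Fin 3) ℝ) : R.1ᵀ * R.1 = 1 :=
  (Matrix.mem_orthogonalGroup_iff' _ _).1 R.2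

theorem mul_transpose_self (R : Matrix.orthogonalGroup (Fin 3) ℝ) :
    R.1 * R.1ᵀ = 1 :=
  (Matrix.mem_orthogonalGroup_iff _ _).1 R.2

theorem act_mul (R S : Matrix.orthogonalGroup (Fin 3) ℝ) (v : Fin 3 → ℝ) :
    act (R * S) v = act R (act S v) := by
  simp [act_apply, Matrix.mulVec_mulVec]

theorem act_one (v : Fin 3 → ℝ) : act (1 : Matrix.orthogonalGroup (Fin 3) ℝ) v = v := by
  simp [act_apply]

theorem act_inv_act (R : Matrix.orthogonalGroup (Fin 3) ℝ) (v : Fin 3 → ℝ) :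
    act R⁻¹ (act R v) = v := by rw [← act_mul, inv_mul_cancel, act_one]

theorem act_act_inv (R : Matrix.orthogonalGroup (Fin 3) ℝ) (v : Fin 3 → ℝ) :
    act R (act R⁻¹ v) = v := by rw [← act_mul, mul_inv_cancel, act_one]

theorem act_smul (R : Matrix.orthogonalGroup (Fin 3) ℝ) (t : ℝ) (v : Fin 3 → ℝ) :
    act R (t • v) = t • act R v := by
  simp [act_apply, Matrix.mulVec_smul]

theorem act_single (R : Matrix.orthogonalGroup (Fin 3) ℝ) (i j : Fin 3) :
    act R (Pi.single j 1) i = R.1 i j := by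
  simp [act_apply]

theorem act_dotProduct_act (R : Matrix.orthogonalGroup (Fin 3) ℝ) (v w : Fin 3 → ℝ) :
    act R v ⬝ᵥ act R w = v ⬝ᵥ w := by
  rw [act_apply, act_apply, Matrix.dotProduct_mulVec, ← Matrix.mulVec_transpose,
    Matrix.mulVec_mulVec, transpose_mul_self, Matrix.one_mulVec]

theorem act_dotProduct (R : Matrix.orthogonalGroup (Fin 3) ℝ) (v w : Fin 3 → ℝ) :
    act R v ⬝ᵥ w = v ⬝ᵥ act R⁻¹ w := by
  rw [← act_dotProduct_act R v (act R⁻¹ w), act_act_inv]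

theorem mem_rotate {R : Matrix.orthogonalGroup (Fin 3) ℝ} {Γ : AddSubgroup (Fin 3 → ℝ)}
    {v : Fin 3 → ℝ} : v ∈ rotate R Γ ↔ act R⁻¹ v ∈ Γ := by
  constructor
  · rintro ⟨w, hw, rfl⟩
    rwa [act_inv_act]
  · intro h
    exact ⟨_, h, act_act_inv R v⟩

theorem act_mem_rotate {R : Matrix.orthogonalGroup (Fin 3) ℝ} {Γ : AddSubgroup (Fin 3 → ℝ)}
    {v : Fin 3 → ℝ} (hv : v ∈ Γ) : act R v ∈ rotate R Γ := ⟨v, hv, rfl⟩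

theorem dotProduct_mem_ints_of_mem_rotate {R : Matrix.orthogonalGroup (Fin 3) ℝ}
    {v w : Fin 3 → ℝ} (hv : v ∈ rotate R cubic) (hw : w ∈ rotate R cubic) : v ⬝ᵥ w ∈ ints := by
  rw [← act_dotProduct_act R⁻¹]
  exact dotProduct_mem_ints (mem_rotate.1 hv) (mem_rotate.1 hw)

/-- The rotated cubic lattice is self-dual. -/
theorem mem_rotate_cubic_of_dotProduct {R : Matrix.orthogonalGroup (Fin 3) ℝ} {v : Fin 3 → ℝ}
    (h : ∀ w ∈ rotate R cubic, v ⬝ᵥ w ∈ ints) : v ∈ rotate R cubic := by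
  rw [mem_rotate, mem_cubic]
  intro i
  -- The `i`-th coordinate of `R⁻¹ v` is the pairing of `v` with `R eᵢ`.
  have := h _ (act_mem_rotate (R := R) (single_mem_cubic i))
  rw [dotProduct_comm, act_dotProduct] at this
  simpa using this

theorem exists_sum_of_mem_cubic {v : Fin 3 → ℝ} (hv : v ∈ cubic)
    (R : Matrix.orthogonalGroup (Fin 3) ℝ) :
    ∃ n : Fin 3 → ℤ, act R v = ∑ j, (n j : ℝ) • act R (Pi.single j 1) := by
  obtain ⟨n, hn⟩ := hv
  refine ⟨n, ?_⟩
  ext i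
  simp [act_apply, Matrix.mulVec, dotProduct, Fin.sum_univ_three, hn]
  ring

/-! ### Denominators of rational orthogonal matrices -/

/-- `N R` is an integer matrix. -/
def Clears (N : ℤ) (R : Matrix.orthogonalGroup (Fin 3) ℝ) : Prop :=
  ∀ i j, (N : ℝ) * R.1 i j ∈ ints

theorem Clears.inv {N : ℤ} {R : Matrix.orthogonalGroup (Fin 3) ℝ} (h : Clears N R) :
    Clears N R⁻¹ := fun i j => h j i

theorem Clears.act_mem {N : ℤ} {R : Matrix.orthogonalGroup (Fin 3) ℝ} (h : Clears N R)
    {v : Fin 3 → ℝ} (hv : v ∈ cubic) : (N : ℝ) • act R v ∈ cubic := by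
  rw [mem_cubic] at *
  intro i
  simp only [Pi.smul_apply, smul_eq_mul, act_apply, Matrix.mulVec, dotProduct, Finset.mul_sum]
  refine sum_mem fun j _ => ?_
  rw [← mul_assoc]
  exact mul_mem (h i j) (hv j)

theorem clears_of_act_mem {N : ℤ} {R : Matrix.orthogonalGroup (Fin 3) ℝ}
    (h : ∀ v ∈ cubic, (N : ℝ) • act R v ∈ cubic) : Clears N R := by
  intro i j
  have := mem_cubic.1 (h _ (single_mem_cubic j)) i
  rwa [Pi.smul_apply, act_single] at this

/-- The order of a finite quotient annihilates it; for infinite index the multiplier is `0` and the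
claim is empty. -/
theorem nsmul_relIndex_mem {A : Type*} [AddCommGroup A] {H K : AddSubgroup A} {a : A}
    (ha : a ∈ K) : H.relIndex K • a ∈ H := by
  have := AddSubgroup.nsmul_index_mem (H.addSubgroupOf K) ⟨a, ha⟩
  rwa [AddSubgroup.mem_addSubgroupOf] at this

theorem clears_relIndex (R : Matrix.orthogonalGroup (Fin 3) ℝ) :
    Clears ((rotate R cubic).relIndex cubic) R := by
  rw [← inv_inv R]
  refine Clears.inv (clears_of_act_mem fun v hv => ?_)
  have := mem_rotate.1 (nsmul_relIndex_mem (H := rotate R cubic) hv)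
  rw [map_nsmul] at this
  rwa [Int.cast_natCast, Nat.cast_smul_eq_nsmul]

/-- A sublattice of `ℤ³` containing `N ℤ³` has finite index. -/
theorem relIndex_cubic_ne_zero {H : AddSubgroup (Fin 3 → ℝ)} {N : ℤ} (hN : N ≠ 0)
    (h : ∀ v ∈ cubic, (N : ℝ) • v ∈ H) : H.relIndex cubic ≠ 0 := by
  let c : (Fin 3 → ℤ) →+ (Fin 3 → ℝ) :=
    { toFun := fun n i => (n i : ℝ)
      map_zero' := by ext; simp
      map_add' := fun _ _ => by ext; simp }
  have hc : cubic = (⊤ : AddSubgroup (Fin 3 → ℤ)).map c := by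
    ext v
    constructor
    · rintro ⟨n, hn⟩
      exact ⟨n, trivial, funext fun i => (hn i).symm⟩
    · rintro ⟨n, -, rfl⟩
      exact ⟨n, fun i => rfl⟩
  rw [hc, ← AddSubgroup.relIndex_comap, AddSubgroup.relIndex_top_right]
  -- Reduction modulo `|N|` has finite target, and its kernel `N ℤ³` lies in the preimage of `H`.
  let r : (Fin 3 → ℤ) →+ (Fin 3 → ZMod N.natAbs) :=
    { toFun := fun n i => (n i : ZMod N.natAbs)
      map_zero' := by ext; simp
      map_add' := fun _ _ => by ext; simp }
  have : NeZero N.natAbs := ⟨by simpa using hN⟩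
  have hr : r.ker.index ≠ 0 := by
    rw [AddSubgroup.index_ker]
    exact Nat.card_pos.ne'
  refine fun h0 => hr (Nat.eq_zero_of_zero_dvd (h0 ▸ AddSubgroup.index_dvd_of_le ?_))
  intro n hn
  have h1 : ∀ i, ∃ k : ℤ, n i = N * k := by
    intro i
    have h2 : ((n i : ℤ) : ZMod N.natAbs) = 0 := congrFun (AddMonoidHom.mem_ker.1 hn) i
    rw [ZMod.intCast_zmod_eq_zero_iff_dvd] at h2
    exact Int.natAbs_dvd.1 h2
  choose k hk using h1
  have h3 := h (fun i => (k i : ℝ)) ⟨k, fun _ => rfl⟩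
  have h4 : c n = (N : ℝ) • fun i => (k i : ℝ) := by
    ext i
    simp [c, hk]
  change c n ∈ H
  rwa [h4]

theorem Clears.relIndex_ne_zero {N : ℤ} {R : Matrix.orthogonalGroup (Fin 3) ℝ} (hN : N ≠ 0)
    (h : Clears N R) : (rotate R cubic).relIndex cubic ≠ 0 := by
  refine relIndex_cubic_ne_zero hN fun v hv => ?_
  rw [mem_rotate, act_smul]
  exact h.inv.act_mem hv

theorem relIndex_rotate_rotate (R : Matrix.orthogonalGroup (Fin 3) ℝ)
    (Γ Δ : AddSubgroup (Fin 3 → ℝ)) : (rotate R Γ).relIndex (rotate R Δ) = Γ.relIndex Δ :=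
  AddSubgroup.relIndex_map_map_of_injective _ _ (act_injective R)

theorem Clears.mem_OC {N : ℤ} {R : Matrix.orthogonalGroup (Fin 3) ℝ} (hN : N ≠ 0)
    (h : Clears N R) : R ∈ OC cubic := by
  refine ⟨?_, h.relIndex_ne_zero hN⟩
  rw [← relIndex_rotate_rotate R⁻¹, ← rotate_mul, inv_mul_cancel, rotate_one]
  exact h.inv.relIndex_ne_zero hN

/-- `N` is the smallest positive integer such that `N R` is an integer matrix `A`. -/
structure IsDenom (R : Matrix.orthogonalGroup (Fin 3) ℝ) (N : ℤ) (A : Fin 3 → Fin 3 → ℤ) :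
    Prop where
  pos : 0 < N
  eq : ∀ i j, (N : ℝ) * R.1 i j = A i j
  isUnit : ∀ g : ℤ, g ∣ N → (∀ i j, g ∣ A i j) → IsUnit g

/-- The least positive multiplier works: a non-unit common factor of `N` and all entries could be
divided out. -/
theorem exists_isDenom {R : Matrix.orthogonalGroup (Fin 3) ℝ} (h : R ∈ OC cubic) :
    ∃ N A, IsDenom R N A := by
  classical
  have hex : ∃ n : ℕ, 0 < n ∧ Clears n R :=
    ⟨_, Nat.pos_of_ne_zero h.2, clears_relIndex R⟩
  obtain ⟨hpos, hcl⟩ := Nat.find_spec hex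
  choose A hA using hcl
  refine ⟨_, A, by exact_mod_cast hpos, fun i j => (hA i j).symm, ?_⟩
  intro g hg hgA
  rcases hg with ⟨m, hm⟩
  choose B hB using hgA
  have hg0 : g ≠ 0 := by rintro rfl; simp at hm
  have hm0 : m ≠ 0 := by rintro rfl; simp at hm
  have hle : Nat.find hex ≤ m.natAbs := by
    refine Nat.find_min' hex ⟨by omega, fun i j => ?_⟩
    have h1 : (m : ℝ) * R.1 i j = B i j := by
      have h2 := hA i j
      have h3 : ((Nat.find hex : ℤ) : ℝ) = g * m := by exact_mod_cast hm
      rw [h3, hB i j] at h2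
      have : (g : ℝ) ≠ 0 := by exact_mod_cast hg0
      apply mul_left_cancel₀ this
      rw [← mul_assoc, ← h2]
      simp
    rcases Int.natAbs_eq m with h | h
    · rw [← h, h1]; exact intCast_mem_ints _
    · have : ((m.natAbs : ℤ) : ℝ) = -(m : ℝ) := by
        have : (m.natAbs : ℤ) = -m := by omega
        exact_mod_cast this
      rw [this, neg_mul, h1]; exact neg_mem (intCast_mem_ints _)
  rw [Int.isUnit_iff_natAbs_eq]
  have h1 := congrArg Int.natAbs hm
  rw [Int.natAbs_mul, Int.natAbs_natCast] at h1
  have h3 : g.natAbs ≠ 0 := by omega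
  have h4 : m.natAbs ≠ 0 := by omega
  by_contra h5
  have : 2 ≤ g.natAbs := by omega
  nlinarith

theorem IsDenom.clears {R : Matrix.orthogonalGroup (Fin 3) ℝ} {N : ℤ} {A : Fin 3 → Fin 3 → ℤ}
    (h : IsDenom R N A) : Clears N R := fun i j => ⟨A i j, (h.eq i j).symm⟩

theorem IsDenom.sum_sq {R : Matrix.orthogonalGroup (Fin 3) ℝ} {N : ℤ} {A : Fin 3 → Fin 3 → ℤ}
    (h : IsDenom R N A) (j : Fin 3) : A 0 j ^ 2 + A 1 j ^ 2 + A 2 j ^ 2 = N ^ 2 := by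
  have h1 := congrFun (congrFun (transpose_mul_self R) j) j
  simp only [Matrix.mul_apply, Fin.sum_univ_three, transpose_apply, one_apply_eq] at h1
  have : ((A 0 j ^ 2 + A 1 j ^ 2 + A 2 j ^ 2 : ℤ) : ℝ) = (N ^ 2 : ℤ) := by
    push_cast
    rw [← h.eq, ← h.eq, ← h.eq]
    linear_combination (N : ℝ) ^ 2 * h1
  exact_mod_cast this

theorem even_of_four_dvd_sum_sq {a b c : ℤ} (h : 4 ∣ a ^ 2 + b ^ 2 + c ^ 2) :
    2 ∣ a ∧ 2 ∣ b ∧ 2 ∣ c := by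
  rcases Int.even_or_odd' a with ⟨a, rfl | rfl⟩ <;>
    rcases Int.even_or_odd' b with ⟨b, rfl | rfl⟩ <;>
    rcases Int.even_or_odd' c with ⟨c, rfl | rfl⟩ <;> ring_nf at h <;> omega

/-- If `N` were even, every column of `A` would have square sum `N²` divisible by 4. This forces
even entries, so 2 would be a common factor. -/
theorem IsDenom.odd {R : Matrix.orthogonalGroup (Fin 3) ℝ} {N : ℤ} {A : Fin 3 → Fin 3 → ℤ}
    (h : IsDenom R N A) : Odd N := by
  by_contra hN
  rw [Int.not_odd_iff_even] at hN
  have h2 : (2 : ℤ) ∣ N := hN.two_dvd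
  have := h.isUnit 2 h2 fun i j => by
    have h4 : (4 : ℤ) ∣ N ^ 2 := by
      obtain ⟨k, rfl⟩ := h2
      exact ⟨k ^ 2, by ring⟩
    rw [← h.sum_sq j] at h4
    obtain ⟨h0, h1, h2⟩ := even_of_four_dvd_sum_sq h4
    fin_cases i <;> assumption
  rw [Int.isUnit_iff] at this
  omega

/-- Divisibility by the coprime entries of `A` and by `N` cancels. -/
theorem IsDenom.mem_of_zsmul_mem {R : Matrix.orthogonalGroup (Fin 3) ℝ} {N : ℤ}
    {A : Fin 3 → Fin 3 → ℤ} (h : IsDenom R N A) {V : Type*} [AddCommGroup V] {X : AddSubgroup V}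
    {s : V} (hN : N • s ∈ X) (hA : ∀ i j, A i j • s ∈ X) : s ∈ X := by
  -- The multipliers carrying `s` into `X` form a subgroup `gℤ`; its generator divides `N` and all
  -- entries of `A`, hence is a unit.
  let I : AddSubgroup ℤ := X.comap (zmultiplesHom V s)
  obtain ⟨g, hg⟩ := Int.subgroup_cyclic I
  have hmem : ∀ n : ℤ, n • s ∈ X → g ∣ n := by
    intro n hn
    have : n ∈ I := by simpa [I] using hn
    rw [hg, AddSubgroup.mem_closure_singleton] at this
    obtain ⟨m, rfl⟩ := this
    exact ⟨m, by simp [mul_comm]⟩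
  have hu := h.isUnit g (hmem N hN) fun i j => hmem _ (hA i j)
  have hgI : g ∈ I := hg ▸ AddSubgroup.subset_closure rfl
  have hgs : g • s ∈ X := by simpa [I] using hgI
  rcases Int.isUnit_iff.1 hu with rfl | rfl
  · simpa using hgs
  · simpa using hgs

/-- The `2 × 2` minors of an orthogonal matrix are, up to sign, its entries. -/
theorem Clears.minor_mem {N : ℤ} {R : Matrix.orthogonalGroup (Fin 3) ℝ} (h : Clears N R)
    (i k j l : Fin 3) :
    (N : ℝ) * (R.1 i j * R.1 k l
      - R.1 i l * R.1 k j) ∈ ints := by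
  set M : Matrix (Fin 3) (Fin 3) ℝ := R.1 with hM
  have hdet : M.det = 1 ∨ M.det = -1 := by
    have := congrArg Matrix.det (transpose_mul_self R)
    rw [det_mul, det_transpose, det_one, ← hM] at this
    exact mul_self_eq_one_iff.1 this
  have hdi : M.det ∈ ints := by
    rcases hdet with h | h <;> rw [h]
    · exact one_mem _
    · exact neg_mem (one_mem _)
  -- The inverse is the transpose, so the matrix of cofactors is `±M`.
  have hadj : M.adjugate = M.det • Mᵀ := by
    have h1 : M.adjugate * (M * Mᵀ) = M.det • Mᵀ := by
      rw [← mul_assoc, adjugate_mul, smul_mul, one_mul]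
    rwa [mul_transpose_self R, mul_one] at h1
  have key : ∀ p q, (N : ℝ) * M.adjugate p q ∈ ints := by
    intro p q
    rw [hadj, Matrix.smul_apply, transpose_apply, smul_eq_mul, mul_left_comm]
    exact mul_mem hdi (h q p)
  rw [adjugate_fin_three] at key
  have swap : ∀ {a b c d e : ℝ}, e * (a * b - c * d) ∈ ints → e * (c * d - a * b) ∈ ints := by
    intro a b c d e h
    have := neg_mem h
    rwa [← mul_neg, neg_sub] at this
  have k00 := key 0 0
  have k01 := key 0 1
  have k02 := key 0 2
  have k10 := key 1 0
  have k11 := key 1 1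
  have k12 := key 1 2
  have k20 := key 2 0
  have k21 := key 2 1
  have k22 := key 2 2
  simp only [of_apply, cons_val', cons_val_zero, cons_val_one, cons_val, neg_add_eq_sub]
    at k00 k01 k02 k10 k11 k12 k20 k21 k22
  have z : ∀ {a b c d e : ℝ}, a * b = c * d → e * (a * b - c * d) ∈ ints := by
    intro a b c d e h
    rw [h, sub_self, mul_zero]; exact zero_mem _
  have comm : ∀ {a b c d e : ℝ}, e * (b * a - d * c) ∈ ints → e * (a * b - c * d) ∈ ints := by
    intro a b c d e h
    rwa [mul_comm a, mul_comm c]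
  fin_cases i <;> fin_cases k <;> fin_cases j <;> fin_cases l <;>
    first
    | exact z (mul_comm _ _)
    | exact z rfl
    | assumption
    | exact swap (by assumption)
    | exact comm (by assumption)
    | exact comm (swap (by assumption))

/-! ### A coincidence site lattice determines the rotated lattice -/

section Determined

variable {R S : Matrix.orthogonalGroup (Fin 3) ℝ} {N : ℤ} {A : Fin 3 → Fin 3 → ℤ}

/-- The vectors `N eᵢ` lie in the CSL of `R`, hence in `S ℤ³`, where all pairings are integral. -/
theorem IsDenom.zsmul_mem_cubic (h : IsDenom R N A)
    (hRS : cubic ⊓ rotate R cubic = cubic ⊓ rotate S cubic) {s : Fin 3 → ℝ}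
    (hs : s ∈ rotate S cubic) : (N : ℝ) • s ∈ cubic := by
  rw [mem_cubic]
  intro i
  have h1 : (N : ℝ) • (Pi.single i 1 : Fin 3 → ℝ) ∈ cubic ⊓ rotate R cubic := by
    refine AddSubgroup.mem_inf.2 ⟨?_, ?_⟩
    · rw [mem_cubic]
      intro j
      exact mul_mem (intCast_mem_ints N) (mem_cubic.1 (single_mem_cubic i) j)
    · rw [mem_rotate, act_smul]
      exact h.clears.inv.act_mem (single_mem_cubic i)
  rw [hRS] at h1
  simpa [mul_comm] using dotProduct_mem_ints_of_mem_rotate hs (AddSubgroup.mem_inf.1 h1).2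

theorem zsmul_eq_smul (n : ℤ) (v : Fin 3 → ℝ) : n • v = (n : ℝ) • v :=
  (Int.cast_smul_eq_zsmul ℝ n v).symm

theorem IsDenom.intCast_mul_apply (h : IsDenom R N A) (i j k l : Fin 3) :
    (A i j : ℝ) * R.1 k l - A i l * R.1 k j ∈ ints := by
  rw [← h.eq, ← h.eq, mul_assoc, mul_assoc, ← mul_sub]
  exact h.clears.minor_mem i k j l

theorem IsDenom.intCast_mul_apply' (h : IsDenom R N A) (i j k l : Fin 3) :
    (A i j : ℝ) * R.1 k l - A k j * R.1 i l ∈ ints := by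
  rw [← h.eq, ← h.eq, mul_assoc, mul_assoc, ← mul_sub, mul_comm (R.1 k j)]
  exact h.clears.minor_mem i k j l

/-- The dual of the coincidence site lattice of `R` is the sum `ℤ³ + R ℤ³`. -/
theorem rotate_le_sup (hR : R ∈ OC cubic)
    (hRS : cubic ⊓ rotate R cubic = cubic ⊓ rotate S cubic) :
    rotate S cubic ≤ cubic ⊔ rotate R cubic := by
  obtain ⟨N, A, h⟩ := exists_isDenom hR
  intro s hs
  have hNs := h.zsmul_mem_cubic hRS hs
  refine h.mem_of_zsmul_mem (AddSubgroup.mem_sup_left (zsmul_eq_smul N s ▸ hNs)) fun k j => ?_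
  obtain ⟨u, hu⟩ := mem_cubic.1 hNs k
  -- Modulo `ℤ³`, `A k j • s` is `N s_k` times `R e_j`. Indeed, integrality of the minors puts `A k
  -- j eᵢ - A i j e_k` in the CSL, so it pairs integrally with `s`.
  have hcub : A k j • s - u • act R (Pi.single j 1) ∈ cubic := by
    rw [mem_cubic]
    intro i
    have hv : (A k j : ℝ) • (Pi.single i 1 : Fin 3 → ℝ) - (A i j : ℝ) • Pi.single k 1
        ∈ cubic ⊓ rotate R cubic := by
      refine AddSubgroup.mem_inf.2 ⟨sub_mem ?_ ?_, ?_⟩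
      · rw [← zsmul_eq_smul]; exact zsmul_mem (single_mem_cubic i) _
      · rw [← zsmul_eq_smul]; exact zsmul_mem (single_mem_cubic k) _
      · rw [mem_rotate, mem_cubic]
        intro l
        rw [map_sub, act_smul, act_smul, Pi.sub_apply, Pi.smul_apply, Pi.smul_apply, act_single,
          act_single]
        exact h.intCast_mul_apply' k j i l
    rw [hRS] at hv
    have := dotProduct_mem_ints_of_mem_rotate hs (AddSubgroup.mem_inf.1 hv).2
    convert this using 1
    have hu' : (u : ℝ) = N * s k := hu
    rw [dotProduct_sub, dotProduct_smul, dotProduct_smul]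
    simp only [zsmul_eq_smul, Pi.sub_apply, Pi.smul_apply, act_single, smul_eq_mul, hu',
      dotProduct_single, mul_one, ← h.eq]
    ring
  have := add_mem (AddSubgroup.mem_sup_left (T := rotate R cubic) hcub)
    (AddSubgroup.mem_sup_right (S := cubic)
      (zsmul_mem (act_mem_rotate (R := R) (single_mem_cubic j)) u))
  rwa [sub_add_cancel] at this

/-- Split `R e_j = l_j + s_j` with `l_j ∈ ℤ³` and `s_j ∈ S ℤ³`. If all pairings `l_j ⬝ᵥ s_t` are
integral, self-duality puts each `l_j` in `S ℤ³`. Integrality holds because the pairing, scaled by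
entries of `A`, is both symmetric and antisymmetric modulo `ℤ`, and `N` is odd. -/
theorem rotate_le_rotate (hR : R ∈ OC cubic) (hS : S ∈ OC cubic)
    (hRS : cubic ⊓ rotate R cubic = cubic ⊓ rotate S cubic) :
    rotate R cubic ≤ rotate S cubic := by
  obtain ⟨N, A, h⟩ := exists_isDenom hR
  have hdec : ∀ j, ∃ l ∈ cubic, ∃ s ∈ rotate S cubic, l + s = act R (Pi.single j 1) := fun j =>
    AddSubgroup.mem_sup.1 (rotate_le_sup hS hRS.symm (act_mem_rotate (single_mem_cubic j)))
  choose l hl s hs hls using hdec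
  have hls' : ∀ j, act R (Pi.single j 1) = l j + s j := fun j => (hls j).symm
  -- This combination of `R e_j` and `R e_t` is integral by the minors, so it lies in the CSL, hence
  -- in both `ℤ³` and `S ℤ³`. Subtracting the component known to lie in one lattice puts the other
  -- component there too.
  have hD : ∀ k j t, (A k t : ℝ) • s j - (A k j : ℝ) • s t ∈ cubic ∧
      (A k t : ℝ) • l j - (A k j : ℝ) • l t ∈ rotate S cubic := by
    intro k j t
    have h1 : (A k t : ℝ) • act R (Pi.single j 1) - (A k j : ℝ) • act R (Pi.single t 1)
        ∈ cubic ⊓ rotate R cubic := by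
      refine AddSubgroup.mem_inf.2 ⟨?_, ?_⟩
      · rw [mem_cubic]
        intro i
        rw [Pi.sub_apply, Pi.smul_apply, Pi.smul_apply, act_single, act_single]
        exact h.intCast_mul_apply k t i j
      · rw [← zsmul_eq_smul, ← zsmul_eq_smul]
        exact sub_mem (zsmul_mem (act_mem_rotate (single_mem_cubic j)) _)
          (zsmul_mem (act_mem_rotate (single_mem_cubic t)) _)
    have h2 : (A k t : ℝ) • l j - (A k j : ℝ) • l t ∈ cubic := by
      rw [← zsmul_eq_smul, ← zsmul_eq_smul]
      exact sub_mem (zsmul_mem (hl j) _) (zsmul_mem (hl t) _)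
    have h3 : (A k t : ℝ) • s j - (A k j : ℝ) • s t ∈ rotate S cubic := by
      rw [← zsmul_eq_smul, ← zsmul_eq_smul]
      exact sub_mem (zsmul_mem (hs j) _) (zsmul_mem (hs t) _)
    have h4 := hRS ▸ h1
    rw [hls' j, hls' t] at h1 h4
    constructor
    · convert sub_mem (AddSubgroup.mem_inf.1 h1).1 h2 using 1
      simp only [smul_add]; abel
    · convert sub_mem (AddSubgroup.mem_inf.1 h4).2 h3 using 1
      simp only [smul_add]; abel
  -- the pairing of the two components is alternating modulo the integers
  have hadd : ∀ j t, l j ⬝ᵥ s t + l t ⬝ᵥ s j ∈ ints := by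
    intro j t
    have h1 : act R (Pi.single j 1) ⬝ᵥ act R (Pi.single t 1) ∈ ints :=
      dotProduct_mem_ints_of_mem_rotate (act_mem_rotate (single_mem_cubic j))
        (act_mem_rotate (single_mem_cubic t))
    have h2 := dotProduct_mem_ints (hl j) (hl t)
    have h3 := dotProduct_mem_ints_of_mem_rotate (hs j) (hs t)
    rw [hls', hls'] at h1
    convert sub_mem (sub_mem h1 h2) h3 using 1
    rw [add_dotProduct, dotProduct_add, dotProduct_add, dotProduct_comm (s j) (l t)]
    ring
  have hleft : ∀ k j t m, (A k t : ℝ) * (l j ⬝ᵥ s m) - A k j * (l t ⬝ᵥ s m) ∈ ints := by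
    intro k j t m
    have := dotProduct_mem_ints_of_mem_rotate (hD k j t).2 (hs m)
    rwa [sub_dotProduct, smul_dotProduct, smul_dotProduct] at this
  have hright : ∀ k j t m, (A k t : ℝ) * (l m ⬝ᵥ s j) - A k j * (l m ⬝ᵥ s t) ∈ ints := by
    intro k j t m
    have := dotProduct_mem_ints (hl m) (hD k j t).1
    rwa [dotProduct_sub, dotProduct_smul, dotProduct_smul] at this
  have hN : ∀ j t, (N : ℝ) * (l j ⬝ᵥ s t) ∈ ints := by
    intro j t
    have := dotProduct_mem_ints (hl j) (h.zsmul_mem_cubic hRS (hs t))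
    rwa [dotProduct_smul] at this
  have hb : ∀ j t, l j ⬝ᵥ s t ∈ ints := by
    intro j t
    refine h.mem_of_zsmul_mem (X := ints.toAddSubgroup) (by rw [zsmul_eq_mul]; exact hN j t)
      fun k m => ?_
    rw [zsmul_eq_mul]
    refine ints_of_two_mul h.odd ?_ ?_
    -- `e1 - e3 + e2` says that `A k m * (l j ⬝ᵥ s t)` is symmetric in `j, t` modulo `ℤ`; `e4` says
    -- it is antisymmetric. So twice it is integral.
    · have e1 := hright k t m j
      have e2 := hleft k j t m
      have e3 := hright k j m t
      have e4 := mul_mem (intCast_mem_ints (A k m)) (hadd j t)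
      convert add_mem (add_mem (sub_mem e1 e3) e2) e4 using 1
      ring
    · rw [mul_left_comm]
      exact mul_mem (intCast_mem_ints _) (hN j t)
  have hlS : ∀ j, l j ∈ rotate S cubic := by
    intro j
    refine mem_rotate_cubic_of_dotProduct fun w hw => ?_
    obtain ⟨w₀, hw₀, w₁, hw₁, rfl⟩ := AddSubgroup.mem_sup.1 (rotate_le_sup hR hRS hw)
    obtain ⟨v, hv, rfl⟩ := hw₁
    obtain ⟨n, hn⟩ := exists_sum_of_mem_cubic hv R
    rw [hn, dotProduct_add, dotProduct_sum]
    refine add_mem (dotProduct_mem_ints (hl j) hw₀) (sum_mem fun t _ => ?_)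
    rw [dotProduct_smul, hls', dotProduct_add]
    exact mul_mem (intCast_mem_ints _) (add_mem (dotProduct_mem_ints (hl j) (hl t)) (hb j t))
  rintro _ ⟨v, hv, rfl⟩
  obtain ⟨n, hn⟩ := exists_sum_of_mem_cubic hv R
  rw [hn]
  refine sum_mem fun t _ => ?_
  rw [← zsmul_eq_smul, hls']
  exact zsmul_mem (add_mem (hlS t) (hs t)) _

/-- The coincidence site lattice `ℤ³ ∩ R ℤ³` determines `R ℤ³`. -/
theorem inf_rotate_eq_iff (hR : R ∈ OC cubic) (hS : S ∈ OC cubic) :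
    cubic ⊓ rotate R cubic = cubic ⊓ rotate S cubic ↔ rotate R cubic = rotate S cubic :=
  ⟨fun h => le_antisymm (rotate_le_rotate hR hS h) (rotate_le_rotate hS hR h.symm),
    fun h => by rw [h]⟩

end Determined

/-! ### The face-centred cubic lattice -/

theorem intCast_mem_fcc {n : Fin 3 → ℤ} :
    (fun i => (n i : ℝ)) ∈ fcc ↔ Even (n 0 + n 1 + n 2) := by
  constructor
  · rintro ⟨t, ht, k, hk⟩
    have h : ∀ i, n i = t i + 2 * k i := fun i =>
      Int.cast_injective (α := ℝ) ((hk i).trans (by push_cast; rfl))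
    rw [h 0, h 1, h 2]
    rcases ht with rfl | rfl | rfl | rfl
    · exact ⟨k 0 + k 1 + k 2, by simp; ring⟩
    · exact ⟨k 0 + k 1 + k 2 + 1, by simp; ring⟩
    · exact ⟨k 0 + k 1 + k 2 + 1, by simp; ring⟩
    · exact ⟨k 0 + k 1 + k 2 + 1, by simp; ring⟩
  · intro h
    have key : ∀ t : Fin 3 → ℤ, (t = ![0, 0, 0] ∨ t = ![1, 1, 0] ∨ t = ![0, 1, 1] ∨
        t = ![1, 0, 1]) → 2 ∣ n 0 - t 0 → 2 ∣ n 1 - t 1 → 2 ∣ n 2 - t 2 →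
        (fun i => (n i : ℝ)) ∈ fcc := by
      intro t ht hd0 hd1 hd2
      have hd : ∀ i, 2 ∣ n i - t i := fun i => by fin_cases i <;> assumption
      choose k hk using hd
      refine ⟨t, ht, k, fun i => ?_⟩
      have : n i = t i + 2 * k i := by linarith [hk i]
      change (n i : ℝ) = _
      rw [this]
      push_cast
      rfl
    rcases Int.emod_two_eq_zero_or_one (n 0) with h0 | h0 <;>
      rcases Int.emod_two_eq_zero_or_one (n 1) with h1 | h1 <;>
      rcases Int.emod_two_eq_zero_or_one (n 2) with h2 | h2 <;>
      first
      | (exfalso; rw [Int.even_iff] at h; omega)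
      | exact key ![0, 0, 0] (by simp) (by simp; omega) (by simp; omega) (by simp; omega)
      | exact key ![1, 1, 0] (by simp) (by simp; omega) (by simp; omega) (by simp; omega)
      | exact key ![0, 1, 1] (by simp) (by simp; omega) (by simp; omega) (by simp; omega)
      | exact key ![1, 0, 1] (by simp) (by simp; omega) (by simp; omega) (by simp; omega)

theorem exists_intCast_of_mem_cubic {v : Fin 3 → ℝ} (hv : v ∈ cubic) :
    ∃ n : Fin 3 → ℤ, v = fun i => (n i : ℝ) := by
  obtain ⟨n, hn⟩ := hv
  exact ⟨n, funext hn⟩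

theorem fcc_le_cubic : fcc ≤ cubic := by
  rintro v ⟨t, -, k, hk⟩
  exact ⟨fun i => t i + 2 * k i, fun i => by rw [hk i]; push_cast; ring⟩

/-- The face-centred cubic lattice consists of the integer vectors of even norm. -/
theorem mem_fcc_iff_dotProduct {v : Fin 3 → ℝ} (hv : v ∈ cubic) :
    v ∈ fcc ↔ ∃ k : ℤ, v ⬝ᵥ v = 2 * k := by
  obtain ⟨n, rfl⟩ := exists_intCast_of_mem_cubic hv
  rw [intCast_mem_fcc]
  have h1 : Even (n 0 + n 1 + n 2) ↔ Even (n 0 * n 0 + n 1 * n 1 + n 2 * n 2) := by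
    simp only [Int.even_add, Int.even_mul, or_self]
  rw [h1, even_iff_exists_two_mul]
  refine exists_congr fun k => ?_
  simp only [dotProduct, Fin.sum_univ_three]
  exact_mod_cast Iff.rfl

theorem add_mem_fcc_iff {v w : Fin 3 → ℝ} (hv : v ∈ cubic) (hw : w ∈ cubic) :
    v + w ∈ fcc ↔ (v ∈ fcc ↔ w ∈ fcc) := by
  obtain ⟨n, rfl⟩ := exists_intCast_of_mem_cubic hv
  obtain ⟨k, rfl⟩ := exists_intCast_of_mem_cubic hw
  have : ((fun i => (n i : ℝ)) + fun i => (k i : ℝ)) = fun i => ((n i + k i : ℤ) : ℝ) := by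
    ext; simp
  rw [this, intCast_mem_fcc, intCast_mem_fcc, intCast_mem_fcc, ← Int.even_add]
  ring_nf

theorem two_smul_mem_fcc {v : Fin 3 → ℝ} (hv : v ∈ cubic) : (2 : ℝ) • v ∈ fcc := by
  rw [two_smul]
  exact (add_mem_fcc_iff hv hv).2 Iff.rfl

theorem smul_mem_fcc {v : Fin 3 → ℝ} (hv : v ∈ fcc) (n : ℤ) : (n : ℝ) • v ∈ fcc :=
  zsmul_eq_smul n v ▸ zsmul_mem hv n

theorem smul_mem_cubic {v : Fin 3 → ℝ} (hv : v ∈ cubic) (n : ℤ) : (n : ℝ) • v ∈ cubic :=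
  zsmul_eq_smul n v ▸ zsmul_mem hv n

/-- `N R` multiplies squared norms by the odd number `N²`, so it preserves their parity. -/
theorem Clears.act_mem_fcc_iff {N : ℤ} {R : Matrix.orthogonalGroup (Fin 3) ℝ} (h : Clears N R)
    (hN : Odd N) {v : Fin 3 → ℝ} (hv : v ∈ cubic) : (N : ℝ) • act R v ∈ fcc ↔ v ∈ fcc := by
  rw [mem_fcc_iff_dotProduct (h.act_mem hv), mem_fcc_iff_dotProduct hv, dotProduct_smul,
    smul_dotProduct, act_dotProduct_act]
  obtain ⟨t, ht⟩ := dotProduct_mem_ints hv hv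
  have ht' : (t : ℝ) = v ⬝ᵥ v := ht
  rw [← ht']
  simp only [smul_eq_mul]
  have : Even (N * (N * t)) ↔ Even t := by
    simp [Int.even_mul, Int.not_even_iff_odd.2 hN]
  rw [even_iff_exists_two_mul, even_iff_exists_two_mul] at this
  exact_mod_cast this

theorem relIndex_fcc_eq_two {Δ : AddSubgroup (Fin 3 → ℝ)} (hΔ : Δ ≤ cubic) {v : Fin 3 → ℝ}
    (hv : v ∈ Δ) (hv' : v ∉ fcc) : fcc.relIndex Δ = 2 := by
  rw [AddSubgroup.relIndex_eq_two_iff_exists_notMem_and]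
  refine ⟨v, hv, hv', fun w hw => ?_⟩
  rw [add_mem_fcc_iff (hΔ hw) (hΔ hv)]
  tauto

theorem single_notMem_fcc (j : Fin 3) : (Pi.single j 1 : Fin 3 → ℝ) ∉ fcc := by
  rw [mem_fcc_iff_dotProduct (single_mem_cubic j)]
  rintro ⟨k, hk⟩
  simp at hk
  have : (1 : ℤ) = 2 * k := by exact_mod_cast hk
  omega

theorem commensurable_fcc_cubic : AddSubgroup.Commensurable fcc cubic := by
  refine ⟨?_, ?_⟩
  · rw [relIndex_fcc_eq_two le_rfl (single_mem_cubic 0) (single_notMem_fcc 0)]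
    simp
  · rw [AddSubgroup.relIndex_eq_one.2 fcc_le_cubic]
    simp

theorem OC_fcc : OC fcc = OC cubic := by
  ext R
  have h1 := commensurable_fcc_cubic
  have h2 := rotate_commensurable R h1
  exact ⟨fun h => h1.symm.trans (AddSubgroup.Commensurable.trans h h2),
    fun h => h1.trans (AddSubgroup.Commensurable.trans h h2.symm)⟩

/-- One finite index suffices: as `2ℤ³ ⊆ fcc ⊆ ℤ³`, twice the index clears the denominators of
`R⁻¹`. -/
theorem mem_OC_of_relIndex_fcc {R : Matrix.orthogonalGroup (Fin 3) ℝ}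
    (h : (rotate R fcc).relIndex fcc ≠ 0) : R ∈ OC cubic := by
  rw [← inv_inv R]
  refine inv_mem (Clears.mem_OC (N := 2 * ((rotate R fcc).relIndex fcc : ℤ)) (by simpa using h)
    (clears_of_act_mem fun v hv => ?_))
  have := mem_rotate.1 (nsmul_relIndex_mem (H := rotate R fcc) (two_smul_mem_fcc hv))
  rw [map_nsmul, act_smul, ← Nat.cast_smul_eq_nsmul ℝ, smul_smul] at this
  convert fcc_le_cubic this using 2
  push_cast
  ring

theorem exists_odd_clears {R : Matrix.orthogonalGroup (Fin 3) ℝ} (h : R ∈ OC cubic) :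
    ∃ N, Odd N ∧ Clears N R := by
  obtain ⟨N, A, hN⟩ := exists_isDenom h
  exact ⟨N, hN.odd, hN.clears⟩

theorem ne_zero_of_odd {N : ℤ} (h : Odd N) : N ≠ 0 := by
  rintro rfl
  simp at h

theorem smul_mem_inf {N : ℤ} {R : Matrix.orthogonalGroup (Fin 3) ℝ} (h : Clears N R)
    {v : Fin 3 → ℝ} (hv : v ∈ cubic) : (N : ℝ) • v ∈ cubic ⊓ rotate R cubic := by
  refine AddSubgroup.mem_inf.2 ⟨smul_mem_cubic hv N, ?_⟩
  rw [mem_rotate, act_smul]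
  exact h.inv.act_mem hv

theorem odd_smul_mem_fcc_iff {N : ℤ} (hN : Odd N) {v : Fin 3 → ℝ} (hv : v ∈ cubic) :
    (N : ℝ) • v ∈ fcc ↔ v ∈ fcc := by
  obtain ⟨k, rfl⟩ := hN
  refine ⟨fun h => ?_, fun h => smul_mem_fcc h _⟩
  have := sub_mem h (smul_mem_fcc (two_smul_mem_fcc hv) k)
  rw [smul_smul, ← sub_smul] at this
  convert this using 1
  push_cast
  rw [show (2 * (k : ℝ) + 1 - k * 2) = 1 by ring, one_smul]

/-- Since `R⁻¹` preserves norms, a vector of the cubic CSL has even norm in both frames or in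
neither. -/
theorem mem_fcc_inf_rotate {R : Matrix.orthogonalGroup (Fin 3) ℝ} {v : Fin 3 → ℝ} :
    v ∈ fcc ⊓ rotate R fcc ↔ v ∈ fcc ∧ v ∈ cubic ⊓ rotate R cubic := by
  rw [AddSubgroup.mem_inf, AddSubgroup.mem_inf, mem_rotate, mem_rotate]
  constructor
  · rintro ⟨h1, h2⟩
    exact ⟨h1, fcc_le_cubic h1, fcc_le_cubic h2⟩
  · rintro ⟨h1, h2, h3⟩
    refine ⟨h1, ?_⟩
    rw [mem_fcc_iff_dotProduct h3, act_dotProduct_act]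
    exact (mem_fcc_iff_dotProduct h2).1 h1

/-- The cubic CSL contains `N e₀`, of odd norm, so its even part has index 2 in it, just as `fcc`
has in `ℤ³`. Compare the two chains from that even part up to `ℤ³`. -/
theorem relIndex_rotate_fcc {R : Matrix.orthogonalGroup (Fin 3) ℝ} (h : R ∈ OC cubic) :
    (rotate R fcc).relIndex fcc = (rotate R cubic).relIndex cubic := by
  obtain ⟨N, hN, hc⟩ := exists_odd_clears h
  have e : fcc ⊓ rotate R fcc = fcc ⊓ (cubic ⊓ rotate R cubic) := by
    ext v
    rw [mem_fcc_inf_rotate]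
    rfl
  have h1 := AddSubgroup.relIndex_mul_relIndex (fcc ⊓ (cubic ⊓ rotate R cubic))
    (cubic ⊓ rotate R cubic) cubic inf_le_right inf_le_left
  have h2 := AddSubgroup.relIndex_mul_relIndex (fcc ⊓ (cubic ⊓ rotate R cubic))
    fcc cubic inf_le_left fcc_le_cubic
  rw [AddSubgroup.inf_relIndex_right, relIndex_fcc_eq_two inf_le_left
    (smul_mem_inf hc (single_mem_cubic 0))
    (by rw [odd_smul_mem_fcc_iff hN (single_mem_cubic 0)]; exact single_notMem_fcc 0),
    AddSubgroup.inf_relIndex_left] at h1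
  rw [← e, AddSubgroup.inf_relIndex_left, e,
    relIndex_fcc_eq_two le_rfl (single_mem_cubic 0) (single_notMem_fcc 0)] at h2
  omega

theorem inf_rotate_fcc_eq_iff {R S : Matrix.orthogonalGroup (Fin 3) ℝ} (hR : R ∈ OC cubic)
    (hS : S ∈ OC cubic) : fcc ⊓ rotate R fcc = fcc ⊓ rotate S fcc ↔
      cubic ⊓ rotate R cubic = cubic ⊓ rotate S cubic := by
  have key : ∀ {R S : Matrix.orthogonalGroup (Fin 3) ℝ}, S ∈ OC cubic →
      fcc ⊓ rotate R fcc = fcc ⊓ rotate S fcc →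
      cubic ⊓ rotate R cubic ≤ cubic ⊓ rotate S cubic := by
    intro R S hS h v hv
    obtain ⟨N, ⟨k, rfl⟩, hc⟩ := exists_odd_clears hS
    -- With `N = 2k + 1` a denominator of `S`, both `N v` and `2 v` lie in the cubic CSL of `S`,
    -- hence so does `v = N v - k (2 v)`.
    have h1 := smul_mem_inf hc (AddSubgroup.mem_inf.1 hv).1
    have h2 : (2 : ℝ) • v ∈ fcc ⊓ rotate R fcc := by
      rw [mem_fcc_inf_rotate]
      refine ⟨two_smul_mem_fcc (AddSubgroup.mem_inf.1 hv).1, ?_⟩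
      rw [two_smul]
      exact add_mem hv hv
    rw [h, mem_fcc_inf_rotate] at h2
    have h3 := sub_mem h1 (zsmul_mem h2.2 k)
    rw [zsmul_eq_smul, smul_smul, ← sub_smul] at h3
    convert h3 using 1
    push_cast
    rw [show (2 * (k : ℝ) + 1 - k * 2) = 1 by ring, one_smul]
  constructor
  · intro h
    exact le_antisymm (key hS h) (key hR h.symm)
  · intro h
    ext v
    rw [mem_fcc_inf_rotate, mem_fcc_inf_rotate, h]

/-! ### Coincidences of shifted lattices -/

section Shifted

variable {x : Fin 3 → ℝ} {Γ : AddSubgroup (Fin 3 → ℝ)} {R : Matrix.orthogonalGroup (Fin 3) ℝ}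

theorem mem_shifted {v : Fin 3 → ℝ} : v ∈ shifted x Γ ↔ v - x ∈ Γ := by
  constructor
  · rintro ⟨g, hg, rfl⟩
    simpa using hg
  · intro h
    exact ⟨_, h, by simp⟩

theorem mem_shiftedInter {v : Fin 3 → ℝ} :
    v ∈ shiftedInter x Γ R ↔ v - x ∈ Γ ∧ v - act R x ∈ rotate R Γ := by
  rw [shiftedInter, Set.mem_inter_iff, mem_shifted]
  refine and_congr_right fun _ => ?_
  rw [mem_rotate, map_sub, act_inv_act, ← mem_shifted]
  constructor
  · rintro ⟨w, hw, rfl⟩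
    rwa [act_inv_act]
  · intro h
    exact ⟨_, h, act_act_inv R v⟩

theorem add_mem_shiftedInter {v : Fin 3 → ℝ} (hv : v ∈ shiftedInter x Γ R) (g : Fin 3 → ℝ) :
    v + g ∈ shiftedInter x Γ R ↔ g ∈ Γ ⊓ rotate R Γ := by
  rw [mem_shiftedInter] at *
  rw [add_sub_right_comm, add_sub_right_comm, AddSubgroup.add_mem_cancel_left _ hv.1,
    AddSubgroup.add_mem_cancel_left _ hv.2, AddSubgroup.mem_inf]

theorem shiftedInter_nonempty :
    (shiftedInter x Γ R).Nonempty ↔ act R x - x ∈ Γ ⊔ rotate R Γ := by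
  constructor
  · rintro ⟨v, hv⟩
    rw [mem_shiftedInter] at hv
    have := sub_mem (AddSubgroup.mem_sup_left (T := rotate R Γ) hv.1)
      (AddSubgroup.mem_sup_right (S := Γ) hv.2)
    simpa using this
  · intro h
    obtain ⟨g, hg, k, hk, h⟩ := AddSubgroup.mem_sup.1 h
    refine ⟨x + g, mem_shiftedInter.2 ⟨by simpa using hg, ?_⟩⟩
    have : x + g - act R x = -k := by
      rw [eq_neg_iff_add_eq_zero, show x + g - act R x + k = x + (g + k) - act R x by abel, h]
      abel
    rw [this]
    exact neg_mem hk

/-- A nonempty intersection is a coset of `Γ ∩ RΓ`, so only nonemptiness and the index of that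
lattice matter. -/
theorem isCosublattice_shiftedInter {m : ℕ} : IsCosublattice x Γ (shiftedInter x Γ R) m ↔
    m ≠ 0 ∧ (shiftedInter x Γ R).Nonempty ∧ (rotate R Γ).relIndex Γ = m := by
  refine and_congr_right fun _ => ?_
  constructor
  · rintro ⟨l, hl, Γ', hle, hm, h⟩
    have hx : x + l ∈ shiftedInter x Γ R := by
      rw [h, mem_shifted, sub_self]
      exact zero_mem _
    refine ⟨⟨_, hx⟩, ?_⟩
    have : Γ' = Γ ⊓ rotate R Γ := by
      ext g
      rw [← add_mem_shiftedInter hx, h, mem_shifted, add_sub_cancel_left]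
    rw [← hm, this, AddSubgroup.inf_relIndex_left]
  · rintro ⟨⟨v, hv⟩, hm⟩
    have hv' := (mem_shiftedInter.1 hv).1
    refine ⟨_, hv', Γ ⊓ rotate R Γ, inf_le_left, by rw [AddSubgroup.inf_relIndex_left, hm], ?_⟩
    rw [add_sub_cancel]
    ext w
    rw [mem_shifted, ← add_mem_shiftedInter hv, add_sub_cancel]

end Shifted

/-! ### The group of coincidence isometries of the shifted face-centred cubic lattice -/

/-- The vector `½(1,1,1)`. -/
noncomputable def halfDiag : Fin 3 → ℝ := fun _ => 1 / 2

theorem odd_of_sum_sq {a b c N : ℤ} (hN : Odd N) (h : a ^ 2 + b ^ 2 + c ^ 2 = 3 * N ^ 2) :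
    Odd a ∧ Odd b ∧ Odd c := by
  obtain ⟨k, rfl⟩ := hN
  simp only [← Int.not_even_iff_odd]
  rcases Int.even_or_odd' a with ⟨a, rfl | rfl⟩ <;>
    rcases Int.even_or_odd' b with ⟨b, rfl | rfl⟩ <;>
    rcases Int.even_or_odd' c with ⟨c, rfl | rfl⟩ <;>
    first
    | (exfalso; ring_nf at h; omega)
    | simp

/-- The integer vector `N R(1,1,1)` has squared norm `3N²`, which is 3 modulo 4, so its coordinates
are all odd, like `N`. Half its difference from `N(1,1,1)` is therefore integral. -/
theorem Clears.smul_act_halfDiag_sub_mem {N : ℤ} {R : Matrix.orthogonalGroup (Fin 3) ℝ}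
    (h : Clears N R) (hN : Odd N) : (N : ℝ) • (act R halfDiag - halfDiag) ∈ cubic := by
  have h1 : (2 : ℝ) • halfDiag ∈ cubic := ⟨fun _ => 1, fun i => by simp [halfDiag]⟩
  obtain ⟨w, hw⟩ := exists_intCast_of_mem_cubic (h.act_mem h1)
  have hsq : w 0 ^ 2 + w 1 ^ 2 + w 2 ^ 2 = 3 * N ^ 2 := by
    have h2 : ((N : ℝ) • act R ((2 : ℝ) • halfDiag)) ⬝ᵥ ((N : ℝ) • act R ((2 : ℝ) • halfDiag))
        = 3 * (N : ℝ) ^ 2 := by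
      rw [dotProduct_smul, smul_dotProduct, act_dotProduct_act]
      simp [dotProduct, halfDiag]
      ring
    rw [hw] at h2
    simp only [dotProduct, Fin.sum_univ_three] at h2
    have h3 : ((w 0 ^ 2 + w 1 ^ 2 + w 2 ^ 2 : ℤ) : ℝ) = (3 * N ^ 2 : ℤ) := by
      push_cast
      linarith
    exact_mod_cast h3
  obtain ⟨h0, h1, h2⟩ := odd_of_sum_sq hN hsq
  have hd : ∀ i, ∃ k, w i - N = 2 * k := by
    intro i
    have hi : Odd (w i) := by fin_cases i <;> assumption
    obtain ⟨k, hk⟩ := hi.sub_odd hN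
    exact ⟨k, by rw [hk]; ring⟩
  choose k hk using hd
  refine ⟨k, fun i => ?_⟩
  have hwi := congrFun hw i
  have hki : (w i : ℝ) - N = 2 * k i := by exact_mod_cast hk i
  rw [act_smul] at hwi
  simp only [Pi.smul_apply, Pi.sub_apply, smul_eq_mul, halfDiag] at *
  linarith

theorem four_smul_halfDiag_mem : (4 : ℝ) • halfDiag ∈ fcc := by
  have := two_smul_mem_fcc (v := (2 : ℝ) • halfDiag) ⟨fun _ => 1, fun i => by simp [halfDiag]⟩
  rw [smul_smul] at this
  convert this using 2
  norm_num

/-- The local criterion at `2` for a coincidence isometry of the shifted lattice. -/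
theorem Clears.act_halfDiag_sub_mem_iff {N : ℤ} {R : Matrix.orthogonalGroup (Fin 3) ℝ}
    (h : Clears N R) (hN : Odd N) : act R halfDiag - halfDiag ∈ fcc ⊔ rotate R fcc ↔
      (N : ℝ) • (act R halfDiag - halfDiag) ∈ fcc := by
  constructor
  · intro hm
    obtain ⟨g, hg, k, ⟨v, hv, rfl⟩, hk⟩ := AddSubgroup.mem_sup.1 hm
    rw [← hk, smul_add]
    exact add_mem (smul_mem_fcc hg N) ((h.act_mem_fcc_iff hN (fcc_le_cubic hv)).2 hv)
  · intro hm
    -- Multiplying by `N` again gives `N² ≡ 1` modulo 4, and the surplus multiple of 4 is harmless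
    -- because `4x = (2,2,2)` lies in `fcc`.
    obtain ⟨k, hk⟩ : ∃ k, N * N = 4 * k + 1 := by
      obtain ⟨j, rfl⟩ := hN
      exact ⟨j * j + j, by ring⟩
    have h1 := smul_mem_fcc hm N
    rw [smul_smul, show (N : ℝ) * N = 4 * k + 1 by exact_mod_cast hk, add_smul, one_smul] at h1
    have h2 : (4 * (k : ℝ)) • (act R halfDiag - halfDiag) ∈ fcc ⊔ rotate R fcc := by
      rw [mul_comm, ← smul_smul, ← zsmul_eq_smul, smul_sub, ← act_smul]
      exact zsmul_mem (sub_mem (AddSubgroup.mem_sup_right (act_mem_rotate four_smul_halfDiag_mem))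
        (AddSubgroup.mem_sup_left four_smul_halfDiag_mem)) _
    have := sub_mem (AddSubgroup.mem_sup_left (T := rotate R fcc) h1) h2
    rwa [add_sub_cancel_left] at this

theorem mem_shiftedOC_iff {R : Matrix.orthogonalGroup (Fin 3) ℝ} :
    R ∈ shiftedOC halfDiag fcc ↔
      R ∈ OC cubic ∧ act R halfDiag - halfDiag ∈ fcc ⊔ rotate R fcc := by
  rw [← shiftedInter_nonempty]
  constructor
  · rintro ⟨m, hm⟩
    obtain ⟨h0, hne, h⟩ := isCosublattice_shiftedInter.1 hm
    exact ⟨mem_OC_of_relIndex_fcc (h ▸ h0), hne⟩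
  · rintro ⟨h, hne⟩
    refine ⟨_, isCosublattice_shiftedInter.2 ⟨?_, hne, relIndex_rotate_fcc h⟩⟩
    exact h.2

theorem Clears.mem_shiftedOC_iff {N : ℤ} {R : Matrix.orthogonalGroup (Fin 3) ℝ}
    (h : Clears N R) (hN : Odd N) : R ∈ shiftedOC halfDiag fcc ↔
      (N : ℝ) • (act R halfDiag - halfDiag) ∈ fcc := by
  rw [CoincidenceLattice.mem_shiftedOC_iff, h.act_halfDiag_sub_mem_iff hN,
    and_iff_right (h.mem_OC (ne_zero_of_odd hN))]

theorem mem_shiftedOCIndex_iff {R : Matrix.orthogonalGroup (Fin 3) ℝ} {m : ℕ} :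
    R ∈ shiftedOCIndex halfDiag fcc m ↔
      R ∈ shiftedOC halfDiag fcc ∧ (rotate R cubic).relIndex cubic = m := by
  rw [CoincidenceLattice.mem_shiftedOC_iff, ← shiftedInter_nonempty]
  constructor
  · intro hm
    obtain ⟨h0, hne, h⟩ := isCosublattice_shiftedInter.1 hm
    have hR := mem_OC_of_relIndex_fcc (h ▸ h0)
    exact ⟨⟨hR, hne⟩, relIndex_rotate_fcc hR ▸ h⟩
  · rintro ⟨⟨hR, hne⟩, h⟩
    exact isCosublattice_shiftedInter.2 ⟨h ▸ hR.2, hne, h ▸ relIndex_rotate_fcc hR⟩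

theorem Clears.mul {N K : ℤ} {R S : Matrix.orthogonalGroup (Fin 3) ℝ} (hR : Clears N R)
    (hS : Clears K S) : Clears (N * K) (R * S) := by
  refine clears_of_act_mem fun v hv => ?_
  have := hR.act_mem (hS.act_mem hv)
  rwa [act_smul, smul_smul, ← act_mul, ← Int.cast_mul] at this

/-- Membership in `OC(x + Γ)` is a character of order two on `OC(Γ)`. -/
theorem mul_mem_shiftedOC_iff {R S : Matrix.orthogonalGroup (Fin 3) ℝ} (hR : R ∈ OC cubic)
    (hS : S ∈ OC cubic) : R * S ∈ shiftedOC halfDiag fcc ↔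
      (R ∈ shiftedOC halfDiag fcc ↔ S ∈ shiftedOC halfDiag fcc) := by
  obtain ⟨N, hN, hRN⟩ := exists_odd_clears hR
  obtain ⟨K, hK, hSK⟩ := exists_odd_clears hS
  rw [(hRN.mul hSK).mem_shiftedOC_iff (hN.mul hK), hRN.mem_shiftedOC_iff hN,
    hSK.mem_shiftedOC_iff hK]
  have hcR := hRN.smul_act_halfDiag_sub_mem hN
  have hcS := hSK.smul_act_halfDiag_sub_mem hK
  -- Cocycle identity for the displacement of `x`. Scaling by the odd `K` and applying `N R` do not
  -- change classes in `ℤ³/fcc`, so the classes add.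
  have e : ((N * K : ℤ) : ℝ) • (act (R * S) halfDiag - halfDiag) =
      (K : ℝ) • ((N : ℝ) • (act R halfDiag - halfDiag)) +
      (N : ℝ) • act R ((K : ℝ) • (act S halfDiag - halfDiag)) := by
    rw [act_smul, act_mul, map_sub, smul_smul, smul_smul, mul_comm (K : ℝ), ← smul_add]
    push_cast
    congr 1
    abel
  rw [e, add_mem_fcc_iff (smul_mem_cubic hcR K) (hRN.act_mem hcS), odd_smul_mem_fcc_iff hK hcR,
    hRN.act_mem_fcc_iff hN hcS]

/-- The group `OC(x + Γ)`. -/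
noncomputable def shiftedGroup : Subgroup (Matrix.orthogonalGroup (Fin 3) ℝ) where
  carrier := shiftedOC halfDiag fcc
  one_mem' := by
    rw [CoincidenceLattice.mem_shiftedOC_iff]
    refine ⟨one_mem _, ?_⟩
    rw [act_one, sub_self]
    exact zero_mem _
  mul_mem' := by
    intro R S hR hS
    rw [mul_mem_shiftedOC_iff (CoincidenceLattice.mem_shiftedOC_iff.1 hR).1
      (CoincidenceLattice.mem_shiftedOC_iff.1 hS).1]
    exact iff_of_true hR hS
  inv_mem' := by
    intro R hR
    have hO := (CoincidenceLattice.mem_shiftedOC_iff.1 hR).1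
    have h1 : (1 : Matrix.orthogonalGroup (Fin 3) ℝ) ∈ shiftedOC halfDiag fcc := by
      rw [CoincidenceLattice.mem_shiftedOC_iff]
      refine ⟨one_mem _, ?_⟩
      rw [act_one, sub_self]
      exact zero_mem _
    rw [← mul_inv_cancel R, mul_mem_shiftedOC_iff hO (inv_mem hO)] at h1
    exact h1.1 hR

theorem mem_shiftedGroup {R : Matrix.orthogonalGroup (Fin 3) ℝ} :
    R ∈ shiftedGroup ↔ R ∈ shiftedOC halfDiag fcc := Iff.rfl

theorem shiftedGroup_le : shiftedGroup ≤ OC cubic := fun _ h =>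
  (CoincidenceLattice.mem_shiftedOC_iff.1 h).1

/-! ### Coset representatives, index 2, and the role of `-1` -/

theorem SO_mem_iff {R : Matrix.orthogonalGroup (Fin 3) ℝ} : R ∈ SO 3 ↔ R.1.det = 1 := Iff.rfl

/-- The rotation by a right angle about the first coordinate axis. -/
def quarterTurn : Matrix.orthogonalGroup (Fin 3) ℝ :=
  ⟨!![1, 0, 0; 0, 0, -1; 0, 1, 0], by
    rw [Matrix.mem_orthogonalGroup_iff]
    ext i j
    fin_cases i <;> fin_cases j <;> simp [Matrix.mul_apply, Fin.sum_univ_three]⟩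

/-- The reflection exchanging the first two coordinates. -/
def swapRefl : Matrix.orthogonalGroup (Fin 3) ℝ :=
  ⟨!![0, 1, 0; 1, 0, 0; 0, 0, 1], by
    rw [Matrix.mem_orthogonalGroup_iff]
    ext i j
    fin_cases i <;> fin_cases j <;> simp [Matrix.mul_apply, Fin.sum_univ_three]⟩

theorem clears_quarterTurn : Clears 1 quarterTurn := by
  intro i j
  rw [Int.cast_one, one_mul]
  fin_cases i <;> fin_cases j <;> simp [quarterTurn]

theorem clears_swapRefl : Clears 1 swapRefl := by
  intro i j
  rw [Int.cast_one, one_mul]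
  fin_cases i <;> fin_cases j <;> simp [swapRefl]

theorem quarterTurn_mem_SO : quarterTurn ∈ SO 3 := by
  rw [SO_mem_iff]
  simp [quarterTurn, Matrix.det_fin_three]

theorem det_swapRefl : swapRefl.1.det = -1 := by
  simp [swapRefl, Matrix.det_fin_three]

theorem quarterTurn_notMem : quarterTurn ∉ shiftedGroup := by
  rw [mem_shiftedGroup, clears_quarterTurn.mem_shiftedOC_iff odd_one, Int.cast_one, one_smul]
  have : act quarterTurn halfDiag - halfDiag = fun i => ((![0, -1, 0] i : ℤ) : ℝ) := by
    ext i
    fin_cases i <;> simp [act_apply, quarterTurn, halfDiag, dotProduct,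
      Fin.sum_univ_three]
    norm_num
  rw [this, intCast_mem_fcc]
  decide

theorem swapRefl_mem : swapRefl ∈ shiftedGroup := by
  rw [mem_shiftedGroup, clears_swapRefl.mem_shiftedOC_iff odd_one, Int.cast_one, one_smul]
  have : act swapRefl halfDiag - halfDiag = 0 := by
    ext i
    fin_cases i <;> simp [act_apply, swapRefl, halfDiag, dotProduct,
      Fin.sum_univ_three]
  rw [this]
  exact zero_mem _

theorem quarterTurn_mem_OC : quarterTurn ∈ OC cubic := clears_quarterTurn.mem_OC one_ne_zero

theorem mul_quarterTurn_mem {R : Matrix.orthogonalGroup (Fin 3) ℝ} (hR : R ∈ OC cubic) :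
    R * quarterTurn ∈ shiftedGroup ↔ R ∉ shiftedGroup := by
  rw [mem_shiftedGroup, mul_mem_shiftedOC_iff hR quarterTurn_mem_OC]
  have := quarterTurn_notMem
  rw [mem_shiftedGroup] at *
  tauto

theorem relIndex_shiftedGroup : shiftedGroup.relIndex (OC fcc) = 2 := by
  rw [OC_fcc, Subgroup.relIndex_eq_two_iff_exists_notMem_and]
  refine ⟨_, quarterTurn_mem_OC, quarterTurn_notMem, fun R hR => ?_⟩
  rw [mul_quarterTurn_mem hR]
  tauto

theorem relIndex_shiftedGroup_SO : (shiftedGroup ⊓ SO 3).relIndex (SOC fcc) = 2 := by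
  rw [SOC, OC_fcc, Subgroup.relIndex_eq_two_iff_exists_notMem_and]
  refine ⟨_, ⟨quarterTurn_mem_OC, quarterTurn_mem_SO⟩, fun h => quarterTurn_notMem h.1,
    fun R hR => ?_⟩
  rw [Subgroup.mem_inf, Subgroup.mem_inf, mul_quarterTurn_mem hR.1]
  have h1 : R ∈ SO 3 := hR.2
  have h2 := mul_mem h1 quarterTurn_mem_SO
  tauto

theorem det_eq_one_or (R : Matrix.orthogonalGroup (Fin 3) ℝ) : R.1.det = 1 ∨ R.1.det = -1 := by
  have := congrArg Matrix.det (transpose_mul_self R)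
  rw [det_mul, det_transpose, det_one] at this
  exact mul_self_eq_one_iff.1 this

theorem mul_swapRefl_mem_SO {R : Matrix.orthogonalGroup (Fin 3) ℝ} :
    R * swapRefl ∈ SO 3 ↔ R ∉ SO 3 := by
  rw [SO_mem_iff, SO_mem_iff, Matrix.UnitaryGroup.mul_val, det_mul, det_swapRefl]
  rcases det_eq_one_or R with h | h <;> rw [h] <;> norm_num

theorem clears_neg {N : ℤ} {R : Matrix.orthogonalGroup (Fin 3) ℝ} (h : Clears N R) :
    Clears N (-R) := fun i j => by
  change (N : ℝ) * -(R.1 i j) ∈ ints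
  rw [mul_neg]
  exact neg_mem (h i j)

theorem neg_mem_OC {R : Matrix.orthogonalGroup (Fin 3) ℝ} (hR : R ∈ OC cubic) :
    -R ∈ OC cubic := by
  obtain ⟨N, hN, hc⟩ := exists_odd_clears hR
  exact (clears_neg hc).mem_OC (ne_zero_of_odd hN)

/-- `-1` moves `½(1,1,1)` by `(-1,-1,-1)`, whose coordinate sum is odd, so `-1` has nontrivial
class. -/
theorem neg_mem_shiftedGroup_iff {R : Matrix.orthogonalGroup (Fin 3) ℝ} (hR : R ∈ OC cubic) :
    -R ∈ shiftedGroup ↔ R ∉ shiftedGroup := by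
  have h1 : (-1 : Matrix.orthogonalGroup (Fin 3) ℝ) ∉ shiftedGroup := by
    have hc : Clears 1 (-1 : Matrix.orthogonalGroup (Fin 3) ℝ) := by
      refine clears_neg fun i j => ?_
      rw [Int.cast_one, one_mul]
      change (1 : Matrix (Fin 3) (Fin 3) ℝ) i j ∈ ints
      rw [one_apply]
      split_ifs
      · exact one_mem _
      · exact zero_mem _
    rw [mem_shiftedGroup, hc.mem_shiftedOC_iff odd_one, Int.cast_one, one_smul]
    have : act (-1 : Matrix.orthogonalGroup (Fin 3) ℝ) halfDiag - halfDiag =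
        fun i => ((-1 : ℤ) : ℝ) := by
      ext i
      have : act (-1 : Matrix.orthogonalGroup (Fin 3) ℝ) halfDiag = - halfDiag := by
        rw [act_apply]
        change (-(1 : Matrix (Fin 3) (Fin 3) ℝ)) *ᵥ _ = _
        rw [neg_mulVec, one_mulVec]
      rw [this]
      simp [halfDiag]
      norm_num
    rw [this, intCast_mem_fcc (n := fun _ => -1)]
    decide
  have h2 := mul_mem_shiftedOC_iff hR (neg_mem_OC (one_mem (OC cubic)))
  rw [mul_neg_one] at h2
  rw [mem_shiftedGroup] at *
  tauto

theorem neg_mem_SO {R : Matrix.orthogonalGroup (Fin 3) ℝ} : -R ∈ SO 3 ↔ R ∉ SO 3 := by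
  rw [SO_mem_iff, SO_mem_iff]
  have : (-R).1.det = - R.1.det := by
    change (-R.1).det = _
    rw [det_neg, Fintype.card_fin]
    ring
  rw [this]
  rcases det_eq_one_or R with h | h <;> rw [h] <;> norm_num

open scoped Quaternion

/-! ### Rational rotations and integer quaternions -/

section Components

variable (q : Quaternion ℤ) (v : Fin 3 → ℝ)

theorem re_toReal : (toReal q).re = q.re := rfl
theorem imI_toReal : (toReal q).imI = q.imI := rfl
theorem imJ_toReal : (toReal q).imJ = q.imJ := rfl
theorem imK_toReal : (toReal q).imK = q.imK := rfl
theorem re_toIm : (toIm v).re = 0 := rfl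
theorem imI_toIm : (toIm v).imI = v 0 := rfl
theorem imJ_toIm : (toIm v).imJ = v 1 := rfl
theorem imK_toIm : (toIm v).imK = v 2 := rfl

end Components

/-- The integer quaternion with given components. -/
def ofComponents (a b c d : ℤ) : Quaternion ℤ := ⟨a, b, c, d⟩

section Components

variable (a b c d : ℤ)

theorem re_ofComponents : (ofComponents a b c d).re = a := rfl
theorem imI_ofComponents : (ofComponents a b c d).imI = b := rfl
theorem imJ_ofComponents : (ofComponents a b c d).imJ = c := rfl
theorem imK_ofComponents : (ofComponents a b c d).imK = d := rfl

end Components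

theorem toReal_zero : toReal 0 = 0 := by
  apply Quaternion.ext <;> exact Int.cast_zero

theorem toReal_sub (p q : Quaternion ℤ) : toReal (p - q) = toReal p - toReal q := by
  apply Quaternion.ext <;> simp [re_toReal, imI_toReal, imJ_toReal, imK_toReal]

theorem toReal_mul (p q : Quaternion ℤ) : toReal (p * q) = toReal p * toReal q := by
  apply Quaternion.ext <;> simp [re_toReal, imI_toReal, imJ_toReal, imK_toReal]

theorem toReal_smul (n : ℤ) (q : Quaternion ℤ) : toReal (n • q) = (n : ℝ) • toReal q := by
  apply Quaternion.ext <;> simp [re_toReal, imI_toReal, imJ_toReal, imK_toReal]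

theorem conjMatrix_smul {t : ℝ} (ht : t ≠ 0) (q : Quaternion ℝ) :
    conjMatrix (t • q) = conjMatrix q := by
  ext i j
  simp only [conjMatrix, of_apply]
  rw [smul_inv₀, smul_mul_assoc, smul_mul_assoc, mul_smul_comm, smul_smul, mul_inv_cancel₀ ht,
    one_smul]

theorem exists_primitive {z : Quaternion ℤ} (hz : z ≠ 0) :
    ∃ (g : ℤ) (p : Quaternion ℤ), g ≠ 0 ∧ IsPrimitive p ∧ z = g • p := by
  let g : ℤ := GCDMonoid.gcd (GCDMonoid.gcd z.re z.imI) (GCDMonoid.gcd z.imJ z.imK)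
  obtain ⟨a, ha⟩ : g ∣ z.re := (gcd_dvd_left _ _).trans (gcd_dvd_left _ _)
  obtain ⟨b, hb⟩ : g ∣ z.imI := (gcd_dvd_left _ _).trans (gcd_dvd_right _ _)
  obtain ⟨c, hc⟩ : g ∣ z.imJ := (gcd_dvd_right _ _).trans (gcd_dvd_left _ _)
  obtain ⟨d, hd⟩ : g ∣ z.imK := (gcd_dvd_right _ _).trans (gcd_dvd_right _ _)
  have hg : g ≠ 0 := by
    intro h
    apply hz
    rw [h, zero_mul] at ha hb hc hd
    apply Quaternion.ext <;> assumption
  refine ⟨g, ofComponents a b c d, hg, ?_, ?_⟩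
  · rintro m ⟨a', ha'⟩ ⟨b', hb'⟩ ⟨c', hc'⟩ ⟨d', hd'⟩
    rw [re_ofComponents] at ha'
    rw [imI_ofComponents] at hb'
    rw [imJ_ofComponents] at hc'
    rw [imK_ofComponents] at hd'
    have : g * m ∣ g * 1 := by
      rw [mul_one]
      refine dvd_gcd (dvd_gcd ⟨a', ?_⟩ ⟨b', ?_⟩) (dvd_gcd ⟨c', ?_⟩ ⟨d', ?_⟩)
      · rw [ha, ha', mul_assoc]
      · rw [hb, hb', mul_assoc]
      · rw [hc, hc', mul_assoc]
      · rw [hd, hd', mul_assoc]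
    exact isUnit_of_dvd_one ((mul_dvd_mul_iff_left hg).1 this)
  · apply Quaternion.ext
    · simpa [re_ofComponents] using ha
    · simpa [imI_ofComponents] using hb
    · simpa [imJ_ofComponents] using hc
    · simpa [imK_ofComponents] using hd

/-! ### Recovering a quaternion from a rotation -/

section Interpolate

variable {𝔸 : Type*} [Ring 𝔸] {i j k a b c : 𝔸}

/-- The relations between the imaginary units. -/
structure IsQuaternionTriple (i j k : 𝔸) : Prop where
  ii : i * i = -1
  jj : j * j = -1
  kk : k * k = -1
  ij : i * j = k
  jk : j * k = i
  ki : k * i = j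
  ji : j * i = -k
  kj : k * j = -i
  ik : i * k = -j

/-- An element intertwining two triples of imaginary units, by averaging. -/
theorem IsQuaternionTriple.intertwine (h : IsQuaternionTriple i j k)
    (h' : IsQuaternionTriple a b c) (w : 𝔸) :
    a * (w - a * w * i - b * w * j - c * w * k) = (w - a * w * i - b * w * j - c * w * k) * i ∧
    b * (w - a * w * i - b * w * j - c * w * k) = (w - a * w * i - b * w * j - c * w * k) * j ∧
    c * (w - a * w * i - b * w * j - c * w * k) = (w - a * w * i - b * w * j - c * w * k) * k := by
  refine ⟨?_, ?_, ?_⟩ <;>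
  · simp only [mul_sub, sub_mul, ← mul_assoc, h'.ii, h'.jj, h'.kk, h'.ij, h'.jk, h'.ki, h'.ji,
      h'.kj, h'.ik]
    simp only [mul_assoc, h.ii, h.jj, h.kk, h.ij, h.jk, h.ki, h.ji, h.kj, h.ik]
    simp only [mul_neg, neg_mul, mul_one, one_mul]
    abel

end Interpolate

/-- The columns of `R` are orthonormal, and `det R = 1` makes the adjugate equal the transpose,
which gives their cross products. Together these are the multiplication table. -/
theorem isQuaternionTriple_rotation {R : Matrix.orthogonalGroup (Fin 3) ℝ} (hR : R ∈ SO 3) :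
    IsQuaternionTriple (toIm (act R (Pi.single 0 1))) (toIm (act R (Pi.single 1 1)))
      (toIm (act R (Pi.single 2 1))) := by
  have horth := transpose_mul_self R
  have hadj : R.1.adjugate = R.1ᵀ := by
    have h1 : R.1.adjugate * (R.1 * R.1ᵀ) = R.1.det • R.1ᵀ := by
      rw [← mul_assoc, adjugate_mul, smul_mul, one_mul]
    rwa [mul_transpose_self R, mul_one, SO_mem_iff.1 hR, one_smul] at h1
  rw [adjugate_fin_three] at hadj
  have e : ∀ p q, _ := fun p q => congrFun (congrFun hadj p) q
  have o : ∀ p q, _ := fun p q => congrFun (congrFun horth p) q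
  have e00 := e 0 0
  have e01 := e 0 1
  have e02 := e 0 2
  have e10 := e 1 0
  have e11 := e 1 1
  have e12 := e 1 2
  have e20 := e 2 0
  have e21 := e 2 1
  have e22 := e 2 2
  have o00 := o 0 0
  have o01 := o 0 1
  have o02 := o 0 2
  have o11 := o 1 1
  have o12 := o 1 2
  have o22 := o 2 2
  simp at e00 e01 e02 e10 e11 e12 e20 e21 e22
  simp [Matrix.mul_apply, Fin.sum_univ_three] at o00 o01 o02 o11 o12 o22
  constructor <;> apply Quaternion.ext <;>
    simp [re_toIm, imI_toIm, imJ_toIm, imK_toIm, act_single] <;> linarith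

theorem isQuaternionTriple_units : IsQuaternionTriple (toIm (Pi.single 0 1))
    (toIm (Pi.single 1 1)) (toIm (Pi.single 2 1)) := by
  have := isQuaternionTriple_rotation (one_mem (SO 3))
  simpa only [act_one] using this

theorem imPart_toIm (v : Fin 3 → ℝ) : imPart (toIm v) = v := by
  ext i
  fin_cases i <;> rfl

theorem conjMatrix_eq_of_intertwine {R : Matrix.orthogonalGroup (Fin 3) ℝ} {q : Quaternion ℝ}
    (hq : q ≠ 0) (h : ∀ j, toIm (act R (Pi.single j 1)) * q = q * toIm (Pi.single j 1)) :
    conjMatrix q = R.1 := by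
  ext i j
  rw [conjMatrix, of_apply, ← h j, mul_inv_cancel_right₀ hq, imPart_toIm, act_single]

/-- Averaging an integer quaternion `w` yields `Q w` with `R eⱼ · Q w = Q w · eⱼ`, so conjugation by
`Q w` is `R` once `Q w ≠ 0`. `N · Q w` has integer components, and scaling does not affect
conjugation, so a primitive representative exists. -/
theorem exists_rotOf_eq {R : Matrix.orthogonalGroup (Fin 3) ℝ} (hR : R ∈ OC cubic)
    (hS : R ∈ SO 3) : ∃ (q : Quaternion ℤ) (hq : IsPrimitive q), R = rotOf q hq := by
  obtain ⟨N, hN, hc⟩ := exists_odd_clears hR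
  have hN0 : (N : ℝ) ≠ 0 := by exact_mod_cast ne_zero_of_odd hN
  let u : Fin 3 → Quaternion ℤ :=
    ![ofComponents 0 1 0 0, ofComponents 0 0 1 0, ofComponents 0 0 0 1]
  have hu : ∀ j, toReal (u j) = toIm (Pi.single j 1) := by
    intro j
    fin_cases j <;> apply Quaternion.ext <;> simp [u, re_toReal, imI_toReal,
      imJ_toReal, imK_toReal, re_toIm, imI_toIm,
      imJ_toIm, imK_toIm, re_ofComponents, imI_ofComponents, imJ_ofComponents, imK_ofComponents]
  choose A hA using hc
  let α : Fin 3 → Quaternion ℤ := fun j => ofComponents 0 (A 0 j) (A 1 j) (A 2 j)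
  have hα : ∀ j, toReal (α j) = (N : ℝ) • toIm (act R (Pi.single j 1)) := by
    intro j
    have h : ∀ i j, (A i j : ℝ) = N * R.1 i j := hA
    apply Quaternion.ext <;> simp [α, act_single, h, re_toReal, imI_toReal,
      imJ_toReal, imK_toReal, re_toIm, imI_toIm,
      imJ_toIm, imK_toIm, re_ofComponents, imI_ofComponents, imJ_ofComponents, imK_ofComponents]
  let Q : Quaternion ℝ → Quaternion ℝ := fun w => w
    - toIm (act R (Pi.single 0 1)) * w * toIm (Pi.single 0 1)
    - toIm (act R (Pi.single 1 1)) * w * toIm (Pi.single 1 1)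
    - toIm (act R (Pi.single 2 1)) * w * toIm (Pi.single 2 1)
  have hint : ∀ w : Quaternion ℤ, ∃ z, toReal z = (N : ℝ) • Q (toReal w) := by
    intro w
    refine ⟨N • w - α 0 * w * u 0 - α 1 * w * u 1 - α 2 * w * u 2, ?_⟩
    simp only [toReal_sub, toReal_mul, toReal_smul, hα, hu, Q, smul_sub, smul_mul_assoc]
  have hex : ∃ w : Quaternion ℤ, Q (toReal w) ≠ 0 := by
    by_contra! h0
    -- These are the diagonal entries of the linear map `Q` in the basis `1, i, j, k`. Its trace is
    -- 4, since `w ↦ a w b` is traceless for imaginary `a, b`; so they cannot all vanish.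
    have h1 := congrArg QuaternionAlgebra.re (h0 (ofComponents 1 0 0 0))
    have h2 := congrArg QuaternionAlgebra.imI (h0 (u 0))
    have h3 := congrArg QuaternionAlgebra.imJ (h0 (u 1))
    have h4 := congrArg QuaternionAlgebra.imK (h0 (u 2))
    simp [Q, u, act_single, re_toReal, imI_toReal, imJ_toReal, imK_toReal, re_toIm, imI_toIm,
      imJ_toIm, imK_toIm, re_ofComponents, imI_ofComponents, imJ_ofComponents, imK_ofComponents]
      at h1 h2 h3 h4
    linarith
  obtain ⟨w, hw⟩ := hex
  obtain ⟨z, hz⟩ := hint w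
  have hz0 : z ≠ 0 := by
    rintro rfl
    rw [toReal_zero] at hz
    exact smul_ne_zero hN0 hw hz.symm
  obtain ⟨g, p, hg, hp, rfl⟩ := exists_primitive hz0
  refine ⟨p, hp, Subtype.ext ?_⟩
  have hg' : (g : ℝ) ≠ 0 := by exact_mod_cast hg
  change R.1 = conjMatrix (toReal p)
  rw [← conjMatrix_smul hg' (toReal p), ← toReal_smul, hz, conjMatrix_smul hN0]
  obtain ⟨i0, i1, i2⟩ :=
    isQuaternionTriple_units.intertwine (isQuaternionTriple_rotation hS) (toReal w)
  refine (conjMatrix_eq_of_intertwine hw fun j => ?_).symm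
  fin_cases j
  · exact i0
  · exact i1
  · exact i2

/-! ### The class of `R_q` in terms of `|q|²` -/

/-- The integer matrix `|q|² R_q`. -/
def intConj (q : Quaternion ℤ) : Matrix (Fin 3) (Fin 3) ℤ :=
  !![q.re ^ 2 + q.imI ^ 2 - q.imJ ^ 2 - q.imK ^ 2, -2 * q.re * q.imK + 2 * q.imI * q.imJ,
      2 * q.re * q.imJ + 2 * q.imI * q.imK;
    2 * q.re * q.imK + 2 * q.imI * q.imJ, q.re ^ 2 - q.imI ^ 2 + q.imJ ^ 2 - q.imK ^ 2,
      -2 * q.re * q.imI + 2 * q.imJ * q.imK;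
    -2 * q.re * q.imJ + 2 * q.imI * q.imK, 2 * q.re * q.imI + 2 * q.imJ * q.imK,
      q.re ^ 2 - q.imI ^ 2 - q.imJ ^ 2 + q.imK ^ 2]

theorem normSq_toReal (q : Quaternion ℤ) :
    Quaternion.normSq (toReal q) = ((Quaternion.normSq q : ℤ) : ℝ) := by
  rw [normSq_int, Quaternion.normSq_def']
  simp [toReal]

theorem normSq_mul_rotOf (q : Quaternion ℤ) (hq : IsPrimitive q) (i j : Fin 3) :
    ((Quaternion.normSq q : ℤ) : ℝ) * (rotOf q hq).1 i j = intConj q i j := by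
  have h0 : ((Quaternion.normSq q : ℤ) : ℝ) ≠ 0 := by
    rw [← normSq_toReal]
    simpa using toReal_ne_zero hq
  change _ * conjMatrix (toReal q) i j = _
  rw [conjMatrix_eq, normSq_toReal, Matrix.smul_apply, smul_eq_mul, mul_inv_cancel_left₀ h0]
  fin_cases i <;> fin_cases j <;> simp [intConj, toReal]

theorem normSq_ne_zero {q : Quaternion ℤ} (hq : IsPrimitive q) : Quaternion.normSq q ≠ 0 := by
  intro h
  have h1 := normSq_toReal q
  rw [h, Int.cast_zero, Quaternion.normSq_eq_zero] at h1
  exact toReal_ne_zero hq h1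

theorem rotOf_mem_OC (q : Quaternion ℤ) (hq : IsPrimitive q) : rotOf q hq ∈ OC cubic :=
  Clears.mem_OC (normSq_ne_zero hq) fun i j => ⟨intConj q i j, (normSq_mul_rotOf q hq i j).symm⟩

theorem rotOf_mem_SO (q : Quaternion ℤ) (hq : IsPrimitive q) : rotOf q hq ∈ SO 3 := by
  rw [SO_mem_iff]
  change (conjMatrix (toReal q)).det = 1
  have hN : Quaternion.normSq (toReal q) ≠ 0 := by simpa using toReal_ne_zero hq
  rw [conjMatrix_eq, det_smul, Fintype.card_fin, inv_pow, inv_mul_eq_one₀ (pow_ne_zero 3 hN),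
    Quaternion.normSq_def', Matrix.det_fin_three]
  simp
  ring

/-- The `i`-th coordinate of `N(Rx - x)` is half of (row sum of `B` minus `N`), and `fcc` asks for
an even coordinate sum. -/
theorem mem_shiftedGroup_iff_four_dvd {R : Matrix.orthogonalGroup (Fin 3) ℝ} {N : ℤ}
    (hN : Odd N) {B : Fin 3 → Fin 3 → ℤ} (h : ∀ i j, (N : ℝ) * R.1 i j = B i j) :
    R ∈ shiftedGroup ↔ 4 ∣ ∑ i, ∑ j, B i j - 3 * N := by
  have hc : Clears N R := fun i j => ⟨B i j, (h i j).symm⟩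
  obtain ⟨n, hn⟩ := exists_intCast_of_mem_cubic (hc.smul_act_halfDiag_sub_mem hN)
  rw [mem_shiftedGroup, hc.mem_shiftedOC_iff hN, hn, intCast_mem_fcc]
  have key : ∀ i, 2 * n i = B i 0 + B i 1 + B i 2 - N := by
    intro i
    have h1 := congrFun hn i
    simp only [Pi.smul_apply, Pi.sub_apply, act_apply, halfDiag, mulVec, dotProduct,
      Fin.sum_univ_three, smul_eq_mul] at h1
    have h2 : (2 * n i : ℝ) = B i 0 + B i 1 + B i 2 - N := by
      rw [← h, ← h, ← h, ← h1]
      ring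
    exact_mod_cast h2
  simp only [Fin.sum_univ_three]
  have h0 := key 0
  have h1 := key 1
  have h2 := key 2
  rw [even_iff_two_dvd]
  constructor <;> intro h <;> omega

/-- Dividing `|q|² R_q` by `k` leaves the odd denominator `N`. In the sum of the entries of `|q|²
R_q` minus `3|q|²`, the real part of `q` cancels. -/
theorem mem_shiftedGroup_iff_of_mul {q : Quaternion ℤ} (hq : IsPrimitive q) {N k : ℤ}
    (hN : Odd N) (hk : Quaternion.normSq q = k * N) (hdvd : ∀ i j, k ∣ intConj q i j) :
    rotOf q hq ∈ shiftedGroup ↔ 4 * k ∣ 4 * (q.imI * q.imJ + q.imI * q.imK + q.imJ * q.imK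
      - q.imI ^ 2 - q.imJ ^ 2 - q.imK ^ 2) := by
  have hk0 : k ≠ 0 := by
    rintro rfl
    exact normSq_ne_zero hq (by rw [hk, zero_mul])
  choose B hB using hdvd
  have h : ∀ i j, (N : ℝ) * (rotOf q hq).1 i j = B i j := by
    intro i j
    have h1 := normSq_mul_rotOf q hq i j
    rw [hk, hB] at h1
    push_cast at h1
    rw [mul_assoc] at h1
    exact mul_left_cancel₀ (by exact_mod_cast hk0) h1
  have hsum : k * (∑ i, ∑ j, B i j - 3 * N) = 4 * (q.imI * q.imJ + q.imI * q.imK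
      + q.imJ * q.imK - q.imI ^ 2 - q.imJ ^ 2 - q.imK ^ 2) := by
    rw [mul_sub, mul_left_comm k, ← hk, normSq_int]
    simp only [Fin.sum_univ_three, mul_add, ← hB]
    simp [intConj]
    ring
  rw [mem_shiftedGroup_iff_four_dvd hN h, ← hsum, mul_comm 4 k, mul_dvd_mul_iff_left hk0]

/-- The divisor `k` is 1, 2 or 4 according as `|q|²` is odd, 2 modulo 4, or 0 modulo 4. In the last
case primitivity makes all components odd. -/
theorem rotOf_mem_shiftedGroup_iff (q : Quaternion ℤ) (hq : IsPrimitive q) :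
    rotOf q hq ∈ shiftedGroup ↔ ¬ Quaternion.normSq q ≡ 2 [ZMOD 4] := by
  have hn := normSq_int q
  have key := fun N k => mem_shiftedGroup_iff_of_mul hq (N := N) (k := k)
  have hprim := hq 2
  generalize rotOf q hq = R at key ⊢
  simp only [intConj] at key
  generalize Quaternion.normSq q = n at *
  generalize q.re = a at *
  generalize q.imI = b at *
  generalize q.imJ = c at *
  generalize q.imK = d at *
  simp only [Int.isUnit_iff] at hprim
  clear hq
  have h4 : n % 4 = 0 ∨ n % 4 = 2 ∨ n % 2 = 1 := by omega
  rcases h4 with h4 | h4 | h4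
  · have hodd : Odd a ∧ Odd b ∧ Odd c ∧ Odd d := by
      rw [hn] at h4
      clear key
      simp only [← Int.not_even_iff_odd]
      rcases Int.even_or_odd' a with ⟨a, rfl | rfl⟩ <;>
        rcases Int.even_or_odd' b with ⟨b, rfl | rfl⟩ <;>
        rcases Int.even_or_odd' c with ⟨c, rfl | rfl⟩ <;>
        rcases Int.even_or_odd' d with ⟨d, rfl | rfl⟩ <;>
        first
        | (exfalso; ring_nf at h4; omega)
        | (exfalso; simp at hprim; done)
        | simp
    obtain ⟨⟨a, rfl⟩, ⟨b, rfl⟩, ⟨c, rfl⟩, ⟨d, rfl⟩⟩ := hodd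
    obtain ⟨a', ha'⟩ := Int.even_mul_succ_self a
    obtain ⟨b', hb'⟩ := Int.even_mul_succ_self b
    obtain ⟨c', hc'⟩ := Int.even_mul_succ_self c
    obtain ⟨d', hd'⟩ := Int.even_mul_succ_self d
    -- `(2a + 1)² = 4a(a + 1) + 1` with `a(a + 1)` even, so four odd squares add up to 4 times an
    -- odd number.
    rw [key (2 * (a' + b' + c' + d') + 1) 4 ⟨_, rfl⟩]
    · refine iff_of_true ?_ (by rw [Int.ModEq]; omega)
      refine ⟨b * c + b * d + c * d - b ^ 2 - c ^ 2 - d ^ 2, ?_⟩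
      ring
    · rw [hn]
      linear_combination 4 * (ha' + hb' + hc' + hd')
    · intro i j
      fin_cases i <;> fin_cases j <;> simp <;> ring_nf <;> omega
  · obtain ⟨N, hN⟩ : ∃ N, n = 2 * N := ⟨n / 2, by omega⟩
    rw [key N 2 (by rw [Int.odd_iff]; omega) hN]
    · refine iff_of_false ?_ (by rw [Int.ModEq]; omega)
      rw [hn] at h4
      clear key hprim
      -- Exactly two components are odd, and then the form in the imaginary components is odd, so 8
      -- does not divide 4 times it.
      rcases Int.even_or_odd' a with ⟨a, rfl | rfl⟩ <;>
        rcases Int.even_or_odd' b with ⟨b, rfl | rfl⟩ <;>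
        rcases Int.even_or_odd' c with ⟨c, rfl | rfl⟩ <;>
        rcases Int.even_or_odd' d with ⟨d, rfl | rfl⟩ <;>
        ring_nf at h4 ⊢ <;> omega
    · rw [hn] at hN
      intro i j
      fin_cases i <;> fin_cases j <;> simp <;> ring_nf <;> omega
  · rw [key n 1 (by rw [Int.odd_iff]; exact h4) (one_mul _).symm]
    · exact iff_of_true (by rw [mul_one]; exact dvd_mul_right _ _) (by rw [Int.ModEq]; omega)
    · intro i j
      exact one_dvd _

/-! ### The point group -/

theorem rotate_cubic_eq_iff {R : Matrix.orthogonalGroup (Fin 3) ℝ} :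
    rotate R cubic = cubic ↔ Clears 1 R := by
  constructor
  · intro h
    refine clears_of_act_mem fun v hv => ?_
    rw [Int.cast_one, one_smul, ← h]
    exact act_mem_rotate hv
  · intro h
    ext v
    rw [mem_rotate]
    constructor
    · intro hv
      have := h.act_mem hv
      rwa [Int.cast_one, one_smul, act_act_inv] at this
    · intro hv
      have := h.inv.act_mem hv
      rwa [Int.cast_one, one_smul] at this

theorem rotate_inv_mul_eq_iff {R S : Matrix.orthogonalGroup (Fin 3) ℝ}
    {Γ : AddSubgroup (Fin 3 → ℝ)} : rotate (R⁻¹ * S) Γ = Γ ↔ rotate R Γ = rotate S Γ := by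
  constructor
  · intro h
    rw [← h, ← rotate_mul, mul_inv_cancel_left, h]
  · intro h
    rw [rotate_mul, ← h, ← rotate_mul, inv_mul_cancel, rotate_one]

/-- The rotations in the point group of the shifted face-centred cubic lattice. -/
noncomputable def pointRotations : Subgroup (Matrix.orthogonalGroup (Fin 3) ℝ) where
  carrier := {R | rotate R cubic = cubic ∧ R ∈ shiftedGroup ∧ R ∈ SO 3}
  one_mem' := ⟨rotate_one _, one_mem _, one_mem _⟩
  mul_mem' := by
    rintro R S ⟨h1, h2, h3⟩ ⟨h4, h5, h6⟩
    exact ⟨by rw [rotate_mul, h4, h1], mul_mem h2 h5, mul_mem h3 h6⟩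
  inv_mem' := by
    rintro R ⟨h1, h2, h3⟩
    refine ⟨?_, inv_mem h2, inv_mem h3⟩
    nth_rw 1 [← h1]
    rw [← rotate_mul, inv_mul_cancel, rotate_one]

theorem mem_pointRotations {R : Matrix.orthogonalGroup (Fin 3) ℝ} :
    R ∈ pointRotations ↔ rotate R cubic = cubic ∧ R ∈ shiftedGroup ∧ R ∈ SO 3 := Iff.rfl

/-- The integer unit vectors. -/
def unitVec : Fin 6 → Fin 3 → ℤ :=
  ![![1, 0, 0], ![-1, 0, 0], ![0, 1, 0], ![0, -1, 0], ![0, 0, 1], ![0, 0, -1]]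

/-- The rows of the rotations in the tetrahedral group. -/
def IsTetrahedral (B : Fin 3 → Fin 3 → ℤ) : Prop :=
  (∀ i j, ∑ k, B i k * B j k = if i = j then 1 else 0) ∧
    B 0 0 * (B 1 1 * B 2 2 - B 1 2 * B 2 1) - B 0 1 * (B 1 0 * B 2 2 - B 1 2 * B 2 0)
      + B 0 2 * (B 1 0 * B 2 1 - B 1 1 * B 2 0) = 1 ∧
    4 ∣ ∑ i, ∑ j, B i j - 3

instance (B : Fin 3 → Fin 3 → ℤ) : Decidable (IsTetrahedral B) := by
  unfold IsTetrahedral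
  infer_instance

theorem card_isTetrahedral :
    Fintype.card {r : Fin 3 → Fin 6 // IsTetrahedral fun i => unitVec (r i)} = 12 := by
  decide +kernel

theorem unitVec_injective : Function.Injective unitVec := by
  decide

theorem exists_unitVec {w : Fin 3 → ℤ} (h : w 0 ^ 2 + w 1 ^ 2 + w 2 ^ 2 = 1) :
    ∃ r, unitVec r = w := by
  have h0 : -1 ≤ w 0 ∧ w 0 ≤ 1 := by constructor <;> nlinarith
  have h1 : -1 ≤ w 1 ∧ w 1 ≤ 1 := by constructor <;> nlinarith
  have h2 : -1 ≤ w 2 ∧ w 2 ≤ 1 := by constructor <;> nlinarith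
  have hw : w = ![w 0, w 1, w 2] := by ext i; fin_cases i <;> rfl
  rw [hw]
  generalize w 0 = a at *
  generalize w 1 = b at *
  generalize w 2 = c at *
  clear hw
  obtain ⟨h0, h0'⟩ := h0
  obtain ⟨h1, h1'⟩ := h1
  obtain ⟨h2, h2'⟩ := h2
  interval_cases a <;> interval_cases b <;> interval_cases c <;> revert h <;> decide

theorem mem_pointRotations_iff {R : Matrix.orthogonalGroup (Fin 3) ℝ} {B : Fin 3 → Fin 3 → ℤ}
    (h : ∀ i j, R.1 i j = B i j) : R ∈ pointRotations ↔ IsTetrahedral B := by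
  have hc : Clears 1 R := fun i j => ⟨B i j, by rw [Int.cast_one, one_mul, h]; rfl⟩
  rw [mem_pointRotations, rotate_cubic_eq_iff, SO_mem_iff, Matrix.det_fin_three,
    mem_shiftedGroup_iff_four_dvd (N := 1) odd_one (B := B) (by simpa using h), IsTetrahedral]
  have h1 : ∀ i j, ∑ k, B i k * B j k = if i = j then 1 else 0 := by
    intro i j
    have := congrFun (congrFun (mul_transpose_self R) i) j
    simp only [Matrix.mul_apply, transpose_apply, one_apply, h] at this
    split_ifs at this ⊢ <;> exact_mod_cast this
  simp only [h]
  have h2 : ((B 0 0 : ℝ) * B 1 1 * B 2 2 - B 0 0 * B 1 2 * B 2 1 - B 0 1 * B 1 0 * B 2 2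
      + B 0 1 * B 1 2 * B 2 0 + B 0 2 * B 1 0 * B 2 1 - B 0 2 * B 1 1 * B 2 0 = 1) ↔
    B 0 0 * (B 1 1 * B 2 2 - B 1 2 * B 2 1) - B 0 1 * (B 1 0 * B 2 2 - B 1 2 * B 2 0)
      + B 0 2 * (B 1 0 * B 2 1 - B 1 1 * B 2 0) = 1 := by
    rw [← Int.cast_inj (α := ℝ)]
    push_cast
    ring_nf
  rw [h2, mul_one]
  tauto

/-- An orthogonal integer matrix has rows among the six integer unit vectors, so the group is in
bijection with a decidable set of triples. -/
theorem card_pointRotations : Nat.card pointRotations = 12 := by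
  rw [← card_isTetrahedral, ← Nat.card_eq_fintype_card]
  have hmat : ∀ r : Fin 3 → Fin 6, IsTetrahedral (fun i => unitVec (r i)) →
      (Matrix.of fun i j => (unitVec (r i) j : ℝ)) ∈ Matrix.orthogonalGroup (Fin 3) ℝ := by
    intro r hr
    rw [Matrix.mem_orthogonalGroup_iff]
    ext i j
    have := hr.1 i j
    simp only [Matrix.mul_apply, of_apply, one_apply, transpose_apply]
    split_ifs at this ⊢ <;> exact_mod_cast this
  symm
  refine Nat.card_eq_of_bijective (fun r : {r : Fin 3 → Fin 6 // IsTetrahedral fun i =>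
    unitVec (r i)} => (⟨⟨_, hmat r.1 r.2⟩, (mem_pointRotations_iff
      (B := fun i => unitVec (r.1 i)) fun _ _ => rfl).2 r.2⟩ : pointRotations)) ⟨?_, ?_⟩
  · intro r s h
    have h1 := congrArg (fun R : pointRotations => R.1.1) h
    refine Subtype.ext (funext fun i => unitVec_injective (funext fun j => ?_))
    have h2 := congrFun (congrFun h1 i) j
    exact Int.cast_injective (α := ℝ) h2
  · intro R
    have hc := rotate_cubic_eq_iff.1 R.2.1
    choose B hB using hc
    have hB' : ∀ i j, R.1.1 i j = B i j := by
      intro i j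
      have h := hB i j
      rw [Int.cast_one, one_mul] at h
      exact h.symm
    have hT := (mem_pointRotations_iff hB').1 R.2
    have hrow : ∀ i, ∃ r, unitVec r = B i := by
      intro i
      apply exists_unitVec
      have := hT.1 i i
      rw [Fin.sum_univ_three, if_pos rfl] at this
      rw [← this]
      ring
    choose r hr using hrow
    have hr' : (fun i => unitVec (r i)) = B := funext hr
    refine ⟨⟨r, hr' ▸ hT⟩, Subtype.ext (Subtype.ext ?_)⟩
    ext i j
    rw [hB' i j, ← hr i]
    rfl

/-! ### Counting -/

/-- The fibres of `f` on `A` are full left cosets of `K`; a section `s` of `f` identifies `A` with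
the image times `K`. -/
theorem ncard_eq_card_mul_ncard_image {G α : Type*} [Group G] (K : Subgroup G) (f : G → α)
    {A : Set G} (hA : ∀ a ∈ A, ∀ k ∈ K, a * k ∈ A)
    (hf : ∀ a ∈ A, ∀ b ∈ A, f a = f b ↔ a⁻¹ * b ∈ K) :
    A.ncard = Nat.card K * (f '' A).ncard := by
  have hs : ∀ y : f '' A, ∃ a ∈ A, f a = y := fun y => y.2
  choose s hsA hs using hs
  rw [← Nat.card_coe_set_eq, ← Nat.card_coe_set_eq, mul_comm, ← Nat.card_prod]
  symm
  refine Nat.card_eq_of_bijective (fun p : (f '' A) × K => (⟨s p.1 * p.2,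
    hA _ (hsA _) _ p.2.2⟩ : A)) ⟨?_, ?_⟩
  · rintro ⟨y, k⟩ ⟨z, l⟩ h
    have h1 : s y * k = s z * l := congrArg Subtype.val h
    have h2 : s y = s z := by
      have : f (s y) = f (s z) := by
        rw [hf _ (hsA _) _ (hsA _)]
        have : (s y)⁻¹ * s z = k * (l : G)⁻¹ := by
          rw [inv_mul_eq_iff_eq_mul, ← mul_assoc, h1, mul_inv_cancel_right]
        rw [this]
        exact mul_mem k.2 (inv_mem l.2)
      rw [hs, hs] at this
      rw [Subtype.ext this]
    have h3 : y = z := Subtype.ext (by rw [← hs, ← hs, h2])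
    rw [h2] at h1
    exact Prod.ext h3 (Subtype.ext (mul_left_cancel h1))
  · rintro ⟨a, ha⟩
    let y : f '' A := ⟨f a, a, ha, rfl⟩
    exact ⟨⟨y, _, (hf _ (hsA y) _ ha).1 (hs y)⟩, Subtype.ext (mul_inv_cancel_left _ _)⟩

theorem abs_entry_le_one (R : Matrix.orthogonalGroup (Fin 3) ℝ) (i j : Fin 3) :
    |R.1 i j| ≤ 1 := by
  have h := congrFun (congrFun (mul_transpose_self R) i) i
  simp only [Matrix.mul_apply, transpose_apply, one_apply_eq] at h
  rw [abs_le_one_iff_mul_self_le_one, ← h]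
  exact Finset.single_le_sum (f := fun k => R.1 i k * R.1 i k) (fun k _ => mul_self_nonneg _)
    (Finset.mem_univ j)

/-- Entries of `R` are bounded by 1, so `m R` is one of finitely many integer matrices. -/
theorem finite_setOf_clears {m : ℤ} (hm : m ≠ 0) :
    {R : Matrix.orthogonalGroup (Fin 3) ℝ | Clears m R}.Finite := by
  let T : Set ℝ := (fun z : ℤ => (z : ℝ) / m) '' Set.Icc (-|m|) |m|
  have hT : T.Finite := (Set.finite_Icc _ _).image _
  have hF : (Set.univ.pi fun _ : Fin 3 => Set.univ.pi fun _ : Fin 3 => T).Finite :=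
    Set.Finite.pi fun _ => Set.Finite.pi fun _ => hT
  refine Set.Finite.of_finite_image (f := fun R => (R.1 : Fin 3 → Fin 3 → ℝ)) (hF.subset ?_)
    (Subtype.val_injective.injOn)
  rintro _ ⟨R, hR, rfl⟩ i - j -
  obtain ⟨z, hz⟩ := hR i j
  have hz' : (z : ℝ) = m * R.1 i j := hz
  have hm' : (m : ℝ) ≠ 0 := by exact_mod_cast hm
  refine ⟨z, ?_, by simp only; rw [hz', mul_div_cancel_left₀ _ hm']⟩
  rw [Set.mem_Icc, ← abs_le]
  have : |(z : ℝ)| ≤ |(m : ℝ)| := by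
    rw [hz', abs_mul]
    exact mul_le_of_le_one_right (abs_nonneg _) (abs_entry_le_one R i j)
  exact_mod_cast this

theorem finite_shiftedOCIndex (m : ℕ) : (shiftedOCIndex halfDiag fcc m).Finite := by
  by_cases hm : m = 0
  -- `IsCosublattice` rules out the value `0`, which encodes infinite index.
  · convert Set.finite_empty
    rw [Set.eq_empty_iff_forall_notMem]
    intro R hR
    exact hR.1 hm
  · refine (finite_setOf_clears (m := m) (by exact_mod_cast hm)).subset fun R hR => ?_
    rw [mem_shiftedOCIndex_iff] at hR
    rw [← hR.2]
    exact clears_relIndex R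

/-- The translations preserving the intersection recover `fcc ∩ R fcc`, hence `R ℤ³`. Conversely,
`R⁻¹S` preserves `ℤ³`, hence `fcc`; lying in the group, it also preserves `x + fcc`. -/
theorem shiftedInter_eq_iff {R S : Matrix.orthogonalGroup (Fin 3) ℝ} (hR : R ∈ shiftedGroup)
    (hS : S ∈ shiftedGroup) : shiftedInter halfDiag fcc R = shiftedInter halfDiag fcc S ↔
      rotate R cubic = rotate S cubic := by
  have hRO := shiftedGroup_le hR
  have hSO := shiftedGroup_le hS
  constructor
  · intro h
    rw [← inf_rotate_eq_iff hRO hSO, ← inf_rotate_fcc_eq_iff hRO hSO]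
    obtain ⟨v, hv⟩ := shiftedInter_nonempty.2 (mem_shiftedOC_iff.1 hR).2
    ext g
    rw [← add_mem_shiftedInter hv, h, add_mem_shiftedInter (h ▸ hv)]
  · intro h
    have hc := rotate_inv_mul_eq_iff.2 h
    have hcl := rotate_cubic_eq_iff.1 hc
    have hfcc : rotate (R⁻¹ * S) fcc = fcc := by
      have key : ∀ {p : Matrix.orthogonalGroup (Fin 3) ℝ}, Clears 1 p → rotate p fcc ≤ fcc := by
        rintro p hp _ ⟨v, hv, rfl⟩
        have := (hp.act_mem_fcc_iff odd_one (fcc_le_cubic hv)).2 hv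
        rwa [Int.cast_one, one_smul] at this
      refine le_antisymm (key hcl) fun v hv => ?_
      rw [mem_rotate]
      exact key hcl.inv (act_mem_rotate hv)
    have hmem := (mem_shiftedOC_iff.1 (mul_mem (inv_mem hR) hS)).2
    rw [hfcc, sup_idem] at hmem
    have hd := act_mem_rotate (R := R) hmem
    rw [map_sub, ← act_mul, mul_inv_cancel_left] at hd
    have hRS := rotate_inv_mul_eq_iff.1 hfcc
    ext v
    rw [mem_shiftedInter, mem_shiftedInter, ← hRS]
    refine and_congr_right fun _ => ?_
    have e : v - act R halfDiag = (v - act S halfDiag) + (act S halfDiag - act R halfDiag) := by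
      abel
    rw [e, AddSubgroup.add_mem_cancel_right _ hd]

theorem rotate_mul_of_clears {p : Matrix.orthogonalGroup (Fin 3) ℝ} (hp : Clears 1 p)
    (R : Matrix.orthogonalGroup (Fin 3) ℝ) : rotate (R * p) cubic = rotate R cubic := by
  rw [rotate_mul, rotate_cubic_eq_iff.2 hp]

theorem mem_shiftedSOCIndex_iff {R : Matrix.orthogonalGroup (Fin 3) ℝ} {m : ℕ} :
    R ∈ shiftedSOCIndex halfDiag fcc m ↔ R ∈ shiftedGroup ∧ R ∈ SO 3 ∧
      (rotate R cubic).relIndex cubic = m := by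
  rw [shiftedSOCIndex, Set.mem_inter_iff, mem_shiftedOCIndex_iff, mem_shiftedGroup,
    SetLike.mem_coe]
  tauto

theorem mul_swapRefl_mem_shiftedOCIndex {R : Matrix.orthogonalGroup (Fin 3) ℝ} {m : ℕ} :
    R * swapRefl ∈ shiftedOCIndex halfDiag fcc m ↔ R ∈ shiftedOCIndex halfDiag fcc m := by
  rw [mem_shiftedOCIndex_iff, mem_shiftedOCIndex_iff, rotate_mul_of_clears clears_swapRefl,
    ← mem_shiftedGroup, ← mem_shiftedGroup, Subgroup.mul_mem_cancel_right _ swapRefl_mem]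

/-- An improper `R` may be replaced by `R * swapRefl`: the swap preserves `ℤ³` and lies in the
group, so the intersection is unchanged. -/
theorem image_shiftedInter (m : ℕ) :
    shiftedInter halfDiag fcc '' shiftedSOCIndex halfDiag fcc m =
      shiftedCslSet halfDiag fcc m := by
  ext S
  constructor
  · rintro ⟨R, hR, rfl⟩
    exact ⟨R, ⟨m, hR.1⟩, rfl, hR.1⟩
  · rintro ⟨R, hR, rfl, h⟩
    by_cases hS : R ∈ SO 3
    · exact ⟨R, ⟨h, hS⟩, rfl⟩
    · refine ⟨R * swapRefl, ⟨mul_swapRefl_mem_shiftedOCIndex.2 h, mul_swapRefl_mem_SO.2 hS⟩, ?_⟩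
      rw [shiftedInter_eq_iff (mul_mem hR swapRefl_mem) hR, rotate_mul_of_clears clears_swapRefl]

/-- Right factors preserving `ℤ³` do not change the CSL: `quarterTurn` repairs membership in the
group, then `swapRefl` the determinant. -/
theorem image_inf_rotate (m : ℕ) :
    (fun R => cubic ⊓ rotate R cubic) '' shiftedSOCIndex halfDiag fcc m = cslSet cubic m := by
  ext L
  constructor
  · rintro ⟨R, hR, rfl⟩
    rw [mem_shiftedSOCIndex_iff] at hR
    exact ⟨R, shiftedGroup_le hR.1, rfl, by rw [AddSubgroup.inf_relIndex_left, hR.2.2]⟩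
  · rintro ⟨R, hR, rfl, h⟩
    rw [AddSubgroup.inf_relIndex_left] at h
    obtain ⟨R', hR', he⟩ : ∃ R' ∈ shiftedGroup, rotate R' cubic = rotate R cubic := by
      by_cases hH : R ∈ shiftedGroup
      · exact ⟨R, hH, rfl⟩
      · exact ⟨_, (mul_quarterTurn_mem hR).2 hH, rotate_mul_of_clears clears_quarterTurn R⟩
    rw [← he] at h ⊢
    by_cases hS : R' ∈ SO 3
    · exact ⟨R', mem_shiftedSOCIndex_iff.2 ⟨hR', hS, h⟩, rfl⟩
    · have hsw := rotate_mul_of_clears clears_swapRefl R'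
      refine ⟨R' * swapRefl, mem_shiftedSOCIndex_iff.2 ⟨mul_mem hR' swapRefl_mem,
        mul_swapRefl_mem_SO.2 hS, hsw ▸ h⟩, by simp only [hsw]⟩

theorem shiftedOCIndex_eq_union (m : ℕ) : shiftedOCIndex halfDiag fcc m =
    shiftedSOCIndex halfDiag fcc m ∪ (· * swapRefl) ⁻¹' shiftedSOCIndex halfDiag fcc m := by
  ext R
  rw [Set.mem_union, Set.mem_preimage, shiftedSOCIndex, Set.mem_inter_iff, Set.mem_inter_iff,
    mul_swapRefl_mem_shiftedOCIndex, SetLike.mem_coe, SetLike.mem_coe, mul_swapRefl_mem_SO]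
  tauto

theorem ncard_shiftedOCIndex (m : ℕ) :
    (shiftedOCIndex halfDiag fcc m).ncard = 2 * (shiftedSOCIndex halfDiag fcc m).ncard := by
  have hfin := finite_shiftedOCIndex m
  rw [shiftedOCIndex_eq_union] at hfin ⊢
  rw [Set.ncard_union_eq _ (hfin.subset Set.subset_union_left)
    (hfin.subset Set.subset_union_right), two_mul]
  · congr 1
    exact Set.ncard_preimage_of_injective_subset_range (mul_left_injective _)
      fun R _ => ⟨R * swapRefl⁻¹, inv_mul_cancel_right _ _⟩
  · rw [Set.disjoint_left]
    intro R h1 h2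
    exact mul_swapRefl_mem_SO.1 h2.2 h1.2

theorem mul_mem_shiftedSOCIndex {m : ℕ} {R p : Matrix.orthogonalGroup (Fin 3) ℝ}
    (hR : R ∈ shiftedSOCIndex halfDiag fcc m) (hp : p ∈ pointRotations) :
    R * p ∈ shiftedSOCIndex halfDiag fcc m := by
  rw [mem_shiftedSOCIndex_iff] at *
  obtain ⟨h1, h2, h3⟩ := hp
  exact ⟨mul_mem hR.1 h2, mul_mem hR.2.1 h3, by rw [rotate_mul, h1, hR.2.2]⟩

theorem inv_mul_mem_pointRotations_iff {R S : Matrix.orthogonalGroup (Fin 3) ℝ} {m : ℕ}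
    (hR : R ∈ shiftedSOCIndex halfDiag fcc m) (hS : S ∈ shiftedSOCIndex halfDiag fcc m) :
    R⁻¹ * S ∈ pointRotations ↔ rotate R cubic = rotate S cubic := by
  rw [mem_shiftedSOCIndex_iff] at *
  rw [mem_pointRotations, rotate_inv_mul_eq_iff]
  exact and_iff_left ⟨mul_mem (inv_mem hR.1) hS.1, mul_mem (inv_mem hR.2.1) hS.2.1⟩

theorem ncard_shiftedSOCIndex_eq_shiftedCslSet (m : ℕ) :
    (shiftedSOCIndex halfDiag fcc m).ncard = 12 * (shiftedCslSet halfDiag fcc m).ncard := by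
  rw [← image_shiftedInter, ← card_pointRotations]
  refine ncard_eq_card_mul_ncard_image _ _ (fun a ha k hk => mul_mem_shiftedSOCIndex ha hk)
    fun a ha b hb => ?_
  rw [inv_mul_mem_pointRotations_iff ha hb, shiftedInter_eq_iff (mem_shiftedSOCIndex_iff.1 ha).1
    (mem_shiftedSOCIndex_iff.1 hb).1]

theorem ncard_shiftedSOCIndex_eq_cslSet (m : ℕ) :
    (shiftedSOCIndex halfDiag fcc m).ncard = 12 * (cslSet cubic m).ncard := by
  rw [← image_inf_rotate, ← card_pointRotations]
  refine ncard_eq_card_mul_ncard_image _ _ (fun a ha k hk => mul_mem_shiftedSOCIndex ha hk)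
    fun a ha b hb => ?_
  rw [inv_mul_mem_pointRotations_iff ha hb, inf_rotate_eq_iff
    (shiftedGroup_le (mem_shiftedSOCIndex_iff.1 ha).1)
    (shiftedGroup_le (mem_shiftedSOCIndex_iff.1 hb).1)]

/-! ### The explicit description -/

theorem shiftedSOC_eq : shiftedSOC halfDiag fcc =
    {R | ∃ (q : Quaternion ℤ) (hq : IsPrimitive q),
      ¬ Quaternion.normSq q ≡ 2 [ZMOD 4] ∧ R = rotOf q hq} := by
  ext R
  constructor
  · rintro ⟨hR, hS⟩
    obtain ⟨q, hq, rfl⟩ := exists_rotOf_eq (shiftedGroup_le hR) hS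
    exact ⟨q, hq, (rotOf_mem_shiftedGroup_iff q hq).1 hR, rfl⟩
  · rintro ⟨q, hq, h, rfl⟩
    exact ⟨(rotOf_mem_shiftedGroup_iff q hq).2 h, rotOf_mem_SO q hq⟩

/-- Negation exchanges proper and improper isometries and also flips the class, so an improper `R`
is in the group exactly when the rotation `-R` is not. -/
theorem shiftedOC_eq : shiftedOC halfDiag fcc = shiftedSOC halfDiag fcc ∪
    {T | ∃ (q : Quaternion ℤ) (hq : IsPrimitive q),
      Quaternion.normSq q ≡ 2 [ZMOD 4] ∧ T = roflOf q hq} := by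
  ext R
  constructor
  · intro hR
    by_cases hS : R ∈ SO 3
    · exact Or.inl ⟨hR, hS⟩
    · right
      have hO := shiftedGroup_le hR
      obtain ⟨q, hq, h⟩ := exists_rotOf_eq (neg_mem_OC hO) (neg_mem_SO.2 hS)
      refine ⟨q, hq, ?_, by rw [roflOf, ← h, neg_neg]⟩
      have h1 : -R ∉ shiftedGroup := fun h => (neg_mem_shiftedGroup_iff hO).1 h hR
      rw [h, rotOf_mem_shiftedGroup_iff, not_not] at h1
      exact h1
  · rintro (h | ⟨q, hq, h, rfl⟩)
    · exact h.1
    · refine (neg_mem_shiftedGroup_iff (rotOf_mem_OC q hq)).2 ?_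
      rw [rotOf_mem_shiftedGroup_iff, not_not]
      exact h

end CoincidenceLattice

open CoincidenceLattice in
theorem lemma7p2 (x : Fin 3 → ℝ) (hx : x = fun _ => 1 / 2) :
    -- the explicit description of the two sets
    shiftedSOC x fcc =
        {R | ∃ (q : Quaternion ℤ) (hq : IsPrimitive q),
          ¬ Quaternion.normSq q ≡ 2 [ZMOD 4] ∧ R = rotOf q hq} ∧
      shiftedOC x fcc = shiftedSOC x fcc ∪
        {T | ∃ (q : Quaternion ℤ) (hq : IsPrimitive q),
          Quaternion.normSq q ≡ 2 [ZMOD 4] ∧ T = roflOf q hq} ∧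
      -- both are subgroups, of index 2
      (∃ H : Subgroup (Matrix.orthogonalGroup (Fin 3) ℝ),
        (H : Set (Matrix.orthogonalGroup (Fin 3) ℝ)) = shiftedSOC x fcc ∧
          H ≤ SOC fcc ∧ H.relIndex (SOC fcc) = 2) ∧
      (∃ H : Subgroup (Matrix.orthogonalGroup (Fin 3) ℝ),
        (H : Set (Matrix.orthogonalGroup (Fin 3) ℝ)) = shiftedOC x fcc ∧
          H ≤ OC fcc ∧ H.relIndex (OC fcc) = 2) ∧
      -- the (finite) numbers of CSLs, coincidence rotations and coincidence isometries of index `m`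
      ∀ m : ℕ,
        (cslSet cubic m).Finite ∧ (shiftedCslSet x fcc m).Finite ∧
          (shiftedSOCIndex x fcc m).Finite ∧ (shiftedOCIndex x fcc m).Finite ∧
          (shiftedCslSet x fcc m).ncard = (cslSet cubic m).ncard ∧
          (shiftedSOCIndex x fcc m).ncard = 12 * (shiftedCslSet x fcc m).ncard ∧
          (shiftedOCIndex x fcc m).ncard = 24 * (shiftedCslSet x fcc m).ncard := by
  obtain rfl : x = halfDiag := hx
  refine ⟨shiftedSOC_eq, shiftedOC_eq, ⟨shiftedGroup ⊓ SO 3, rfl, ?_, relIndex_shiftedGroup_SO⟩,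
    ⟨shiftedGroup, rfl, ?_, relIndex_shiftedGroup⟩, fun m => ?_⟩
  · rw [SOC, OC_fcc]
    exact inf_le_inf_right _ shiftedGroup_le
  · rw [OC_fcc]
    exact shiftedGroup_le
  · have hfin := finite_shiftedOCIndex m
    have hSfin : (shiftedSOCIndex halfDiag fcc m).Finite := hfin.subset Set.inter_subset_left
    have h1 := ncard_shiftedSOCIndex_eq_shiftedCslSet m
    have h2 := ncard_shiftedSOCIndex_eq_cslSet m
    have h3 := ncard_shiftedOCIndex m
    refine ⟨image_inf_rotate m ▸ hSfin.image _, image_shiftedInter m ▸ hSfin.image _, hSfin, hfin,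
      ?_, h1, ?_⟩ <;> omega
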